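/- All hypergraphs are finite and have no repeated hyperedges. A hypergraph is \(k\)-uniform if each hyperedge has exactly \(k\) vertices; a hypertree is a connected hypergraph without (Berge) cycles, where cycles of length \(2\), i.e. two hyperedges sharing two vertices, count as cycles. The hyperpath \(P_m^{(k)}\) has the vertices \(0,1,\dots,m(k-1)\) and the \(m\) hyperedges \(\{i(k-1),\,i(k-1)+1,\dots,(i+1)(k-1)\}\), \(0\le i<m\). For a \(k\)-uniform hypergraph \(\mathcal H\) on \(n\) vertices let \(\mathcal A(\mathcal H)\) be its adjacency tensor, of order \(k\) and dimension \(n\), with entry \(a_{i_1\cdots i_k}=\frac1{(k-1)!}\) if \(\{i_1,\dots,i_k\}\in E(\mathcal H)\) and \(0\) otherwise; let \(\mathcal D(\mathcal H)\) be the diagonal tensor of the vertex degrees, and \(\mathcal A_\alpha(\mathcal H)=\alpha\mathcal D(\mathcal H)+(1-\alpha)\mathcal A(\mathcal H)\). The \(d\)-th order trace of a tensor \(\mathcal T\) of order \(k\) and dimension \(n\) is \[ \mathrm{Tr}_d(\mathcal T)=(k-1)^{n-1}\sum_{d_1+\cdots+d_n=d}\ \prod_{i=1}^n\frac1{(d_i(k-1))!}\Bigl(\sum_{x\in[n]^{k-1}}\mathcal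 T_{ix}\frac{\partial}{\partial a_{ix}}\Bigr)^{d_i}\mathrm{tr}\bigl(A^{d(k-1)}\bigr), \] where \(A=(a_{ij})\) is an \(n\times n\) matrix of indeterminates, the \(d_i\) are nonnegative integers, and \(\frac{\partial}{\partial a_{ix}}=\frac{\partial}{\partial a_{ii_2}}\cdots\frac{\partial}{\partial a_{ii_k}}\) for \(x=i_2\cdots i_k\). For \(k\)-uniform hypergraphs \(\mathcal H_1,\mathcal H_2\) with the same number \(n\) of vertices, write \(\mathcal H_1\prec_\alpha\mathcal H_2\) (\(\mathcal H_1\) comes before \(\mathcal H_2\) in \(S_\alpha\)-order) if there is an integer \(d\) with \(1\le d\le n(k-1)^{n-1}-1\) such that \(\mathrm{Tr}_t(\mathcal A_\alpha(\mathcal H_1))=\mathrm{Tr}_t(\mathcal A_\alpha(\mathcal H_2))\) for \(t=0,1,\dots,d-1\) and \(\mathrm{Tr}_d(\mathcal A_\alpha(\mathcal H_1))<\mathrm{Tr}_d(\mathcal A_\alpha(\mathcal H_2))\). Write \(\mathcal H_1=_\alpha\mathcal H_2\) if the traces of all orders \(t=0,1,\dots,n(k-1)^{n-1}-1\) agree,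 and \(\mathcal H_1\preceq_\alpha\mathcal H_2\) if \(\mathcal H_1\prec_\alpha\mathcal H_2\) or \(\mathcal H_1=_\alpha\mathcal H_2\). **Theorem.** Let \(k\ge3\), \(m\ge0\) and \(0<\alpha<1\). Among all \(k\)-uniform hypertrees with \(m\) hyperedges, the hyperpath \(P_m^{(k)}\) is the first in \(S_\alpha\)-order. That is, \(P_m^{(k)}\) is a \(k\)-uniform hypertree with \(m\) hyperedges, and every \(k\)-uniform hypertree \(T\) with \(m\) hyperedges has the same number of vertices as \(P_m^{(k)}\) and satisfies \(P_m^{(k)}\preceq_\alpha T\), and \(P_m^{(k)}\prec_\alpha T\) whenever \(T\) is not isomorphic to \(P_m^{(k)}\). -/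

import Mathlib

/-! ### Tensors and their traces -/

/-- A tensor of order `k` (`k ≥ 1`) whose indices range over `ι`. The entry with index
`i i₂ ⋯ i_k` is `𝓐 i x`, where `x = (i₂, …, i_k)` has `k - 1` components. -/
abbrev HTensor (k : ℕ) (ι R : Type*) : Type _ := ι → (Fin (k - 1) → ι) → R

namespace HTensor

variable {k : ℕ} {ι R : Type*} [Field R]

/-- The constant-coefficient operator `∂/∂a_{ix} = ∂/∂a_{i i₂} ⋯ ∂/∂a_{i i_k}`, for
`x = (i₂, …, i_k)`, on the polynomials in the entries `a_{ij}` of the auxiliary matrix. -/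
noncomputable def partialOp (i : ι) (x : Fin (k - 1) → ι) :
    Module.End R (MvPolynomial (ι × ι) R) :=
  (List.ofFn fun j => (MvPolynomial.pderiv (R := R) (i, x j)).toLinearMap).prod

/-- The operator `∑_x 𝓐_{ix} ∂/∂a_{ix}`, where `x` runs over all `(k-1)`-tuples of indices. -/
noncomputable def rowOp [Fintype ι] (A : HTensor k ι R) (i : ι) :
    Module.End R (MvPolynomial (ι × ι) R) :=
  open Classical in ∑ x : Fin (k - 1) → ι, A i x • partialOp i x

theorem pderiv_commute (a b : ι × ι) :
    Commute (MvPolynomial.pderiv (R := R) a).toLinearMap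
      ((MvPolynomial.pderiv (R := R) b).toLinearMap :
        Module.End R (MvPolynomial (ι × ι) R)) := by
  have h : ⁅MvPolynomial.pderiv (R := R) a, MvPolynomial.pderiv (R := R) b⁆ = 0 := by
    classical
    apply MvPolynomial.derivation_ext
    intro i
    simp [Derivation.commutator_apply, MvPolynomial.pderiv_X, Pi.single_apply, apply_ite]
  refine LinearMap.ext fun p => ?_
  have := DFunLike.congr_fun h p
  rw [Derivation.commutator_apply] at this
  exact sub_eq_zero.mp this

theorem rowOp_commute [Fintype ι] (A : HTensor k ι R) (i j : ι) :
    Commute (rowOp A i) (rowOp A j) := by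
  unfold rowOp partialOp
  refine Commute.sum_left _ _ _ fun x _ => Commute.sum_right _ _ _ fun y _ => ?_
  refine Commute.smul_left (Commute.smul_right ?_ _) _
  refine Commute.list_prod_left _ _ fun f hf => Commute.list_prod_right _ _ fun g hg => ?_
  obtain ⟨a, rfl⟩ := List.mem_ofFn.mp hf
  obtain ⟨b, rfl⟩ := List.mem_ofFn.mp hg
  exact pderiv_commute _ _

theorem rowOp_pairwise [Fintype ι] (A : HTensor k ι R) (δ : ι → ℕ) :
    ((Finset.univ : Finset ι) : Set ι).Pairwise (Function.onFun Commute
      fun i => ((Nat.factorial (δ i * (k - 1)) : R)⁻¹) • rowOp A i ^ δ i) :=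
  fun i _ j _ _ => (((rowOp_commute A i j).pow_pow _ _).smul_left _).smul_right _

/-- The `d`-th order trace of a tensor of order `k` and dimension `n = |ι|`,
`Tr_d(𝓐) = (k-1)^{n-1} ∑_{d₁+⋯+d_n=d} ∏_i 1/(d_i(k-1))! (∑_x 𝓐_{ix} ∂/∂a_{ix})^{d_i} tr(A^{d(k-1)})`,
where `A = (a_{ij})` is the auxiliary matrix of `n²` variables. The operator has the same order
as the degree of the homogeneous polynomial `tr(A^{d(k-1)})`, so that the result is a constant
polynomial; `constantCoeff` reads it as a scalar. -/
noncomputable def trace [Fintype ι] (d : ℕ) (A : HTensor k ι R) : R :=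
  open Classical in
  ((k : R) - 1) ^ (Fintype.card ι - 1) *
    ∑ δ ∈ Finset.piAntidiag (Finset.univ : Finset ι) d,
      MvPolynomial.constantCoeff
        ((Finset.univ.noncommProd
            (fun i => ((Nat.factorial (δ i * (k - 1)) : R)⁻¹) • rowOp A i ^ δ i)
            (rowOp_pairwise A δ))
          (Matrix.trace (Matrix.mvPolynomialX ι ι R ^ (d * (k - 1)))))

end HTensor

/-! ### Hypergraphs -/

namespace Hypergraph

/-- Every hyperedge has exactly `k` vertices. -/
def IsUniform {V : Type*} (H : Hypergraph V) (k : ℕ) : Prop :=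
  ∀ e ∈ H.edgeSet, e.ncard = k

/-- The number of hyperedges that contain `v`. -/
noncomputable def degree {V : Type*} (H : Hypergraph V) (v : V) : ℕ :=
  {e ∈ H.edgeSet | v ∈ e}.ncard

/-- There is a vertex, and any two vertices are joined by a walk. -/
def IsConnected {V : Type*} (H : Hypergraph V) : Prop :=
  H.vertexSet.Nonempty ∧
    ∀ u ∈ H.vertexSet, ∀ v ∈ H.vertexSet, Relation.ReflTransGen H.Adj u v

/-- A (Berge) cycle `v₀ e₀ v₁ e₁ ⋯ v_{l+1} e_{l+1} v₀` of length `l + 2 ≥ 2`: distinct vertices,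
distinct hyperedges, and `v_i, v_{i+1} ∈ e_i` with indices modulo the length. -/
def IsCycle {V : Type*} (H : Hypergraph V) {l : ℕ}
    (v : Fin (l + 2) → V) (e : Fin (l + 2) → Set V) : Prop :=
  Function.Injective v ∧ Function.Injective e ∧
    ∀ i, e i ∈ H.edgeSet ∧ v i ∈ e i ∧ v (i + 1) ∈ e i

/-- A hypertree is a connected hypergraph without cycles. -/
def IsHypertree {V : Type*} (H : Hypergraph V) : Prop :=
  H.IsConnected ∧
    ∀ (l : ℕ) (v : Fin (l + 2) → V) (e : Fin (l + 2) → Set V), ¬ H.IsCycle v e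

/-- Two hypergraphs are isomorphic: a bijection of the vertex sets matches the hyperedges. -/
def IsIsomorphic {V W : Type*} (H : Hypergraph V) (G : Hypergraph W) : Prop :=
  ∃ σ : H.vertexSet ≃ G.vertexSet, ∀ s : Set H.vertexSet,
    Subtype.val '' s ∈ H.edgeSet ↔ Subtype.val '' (σ '' s) ∈ G.edgeSet

/-- The `k`-uniform hyperpath with `m` hyperedges: its vertices are `0, 1, …, m(k-1)`, and its
hyperedges are the blocks `{i(k-1), i(k-1)+1, …, (i+1)(k-1)}` for `0 ≤ i < m`, so that consecutive
hyperedges share exactly one vertex. -/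
def hyperpath (k m : ℕ) : Hypergraph ℕ where
  vertexSet := Set.Iic (m * (k - 1))
  edgeSet := {e | ∃ i < m, e = Set.Icc (i * (k - 1)) ((i + 1) * (k - 1))}
  subset_vertexSet_of_mem_edgeSet' := by
    rintro e ⟨i, hi, rfl⟩ x hx
    exact hx.2.trans (Nat.mul_le_mul_right _ hi)

instance (k m : ℕ) : Fintype (hyperpath k m).vertexSet :=
  inferInstanceAs (Fintype (Set.Iic (m * (k - 1))))

/-- The adjacency tensor of a `k`-uniform hypergraph: the entry with index `i₁ i₂ ⋯ i_k` is
`1/(k-1)!` if `{i₁, …, i_k}` is a hyperedge, and `0` otherwise. -/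
noncomputable def adjTensor {V : Type*} (H : Hypergraph V) (k : ℕ) : HTensor k H.vertexSet ℝ :=
  open Classical in
  fun i x =>
    if insert (i : V) (Set.range fun j => (x j : V)) ∈ H.edgeSet
    then 1 / (Nat.factorial (k - 1) : ℝ) else 0

/-- The degree tensor: the diagonal tensor of order `k` of the vertex degrees. -/
noncomputable def degTensor {V : Type*} (H : Hypergraph V) (k : ℕ) : HTensor k H.vertexSet ℝ :=
  open Classical in
  fun i x => if ∀ j, x j = i then (H.degree (i : V) : ℝ) else 0

/-- The `𝓐_α`-tensor `α 𝓓(H) + (1 - α) 𝓐(H)`. -/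
noncomputable def alphaTensor {V : Type*} (H : Hypergraph V) (k : ℕ) (α : ℝ) :
    HTensor k H.vertexSet ℝ :=
  α • H.degTensor k + (1 - α) • H.adjTensor k

/-- The `d`-th order trace of the `𝓐_α`-tensor, that is, the `d`-th `𝓐_α`-spectral moment. -/
noncomputable def alphaTrace {V : Type*} (H : Hypergraph V) [Fintype H.vertexSet]
    (k : ℕ) (α : ℝ) (d : ℕ) : ℝ :=
  HTensor.trace d (H.alphaTensor k α)

/-- `H` comes before `G` in `S_α`-order, `H ≺_α G`: both have the same number `n` of vertices, and
for some `d` with `1 ≤ d ≤ n(k-1)^{n-1} - 1` the traces of all orders below `d` agree and the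
one of order `d` is smaller for `H`. -/
def AlphaLT {V W : Type*} (k : ℕ) (α : ℝ) (H : Hypergraph V) (G : Hypergraph W)
    [Fintype H.vertexSet] [Fintype G.vertexSet] : Prop :=
  Fintype.card H.vertexSet = Fintype.card G.vertexSet ∧
    ∃ d : ℕ, 1 ≤ d ∧
      d ≤ Fintype.card H.vertexSet * (k - 1) ^ (Fintype.card H.vertexSet - 1) - 1 ∧
      (∀ t < d, H.alphaTrace k α t = G.alphaTrace k α t) ∧
      H.alphaTrace k α d < G.alphaTrace k α d

/-- `H =_α G`: both have the same number `n` of vertices, and the traces of the orders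
`0, 1, …, n(k-1)^{n-1} - 1` agree. -/
def AlphaEq {V W : Type*} (k : ℕ) (α : ℝ) (H : Hypergraph V) (G : Hypergraph W)
    [Fintype H.vertexSet] [Fintype G.vertexSet] : Prop :=
  Fintype.card H.vertexSet = Fintype.card G.vertexSet ∧
    ∀ t ≤ Fintype.card H.vertexSet * (k - 1) ^ (Fintype.card H.vertexSet - 1) - 1,
      H.alphaTrace k α t = G.alphaTrace k α t

/-- `H ≼_α G`: `H ≺_α G` or `H =_α G`. -/
def AlphaLE {V W : Type*} (k : ℕ) (α : ℝ) (H : Hypergraph V) (G : Hypergraph W)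
    [Fintype H.vertexSet] [Fintype G.vertexSet] : Prop :=
  AlphaLT k α H G ∨ AlphaEq k α H G

end Hypergraph

/-!
Under the pairing of polynomials for which distinct monomials are orthogonal, `∂/∂a` is adjoint to
multiplication by `a`. So the trace of order `d` is a sum, over row multiplicities `δ` of total `d`,
of pairings of `∏ i, (row polynomial of i) ^ δ i` with `tr (A ^ (d (k - 1)))`, whose monomials are
the arc multisets of closed walks.

In a hypertree, removing an edge `e` separates its vertices from one another. A closed walk crosses
each of these cuts equally often in both directions, which forces `e` to be used the same number of
times in the row of each of its vertices. Two uses of edges thus need `d ≥ 2k`, and for `0 < d < 2k`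
only diagonal factors and at most one edge contribute: up to a common factor the trace is
`∑ v, (α deg v) ^ d + (1 - α) ^ k ∑ e, F_d(e)`, where `F_d(e)` is a symmetric polynomial of degree
`d - k` in the numbers `α deg v`, `v ∈ e`, with positive coefficients, and vanishes for `d < k`.

All `k`-uniform hypertrees with `m` edges have the same number of vertices and the same degree sum.
Hence order `2` compares `∑ v, deg v ^ 2`, which is least exactly when all degrees are at most `2`.
Among those trees, the vertex parts agree in every order, and so do the edge parts up to order
`k + 1`; order `k + 2` compares `∑ e, (∑ v ∈ e, deg v) ^ 2`, which is least exactly when every edge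
meets at most two others. Then the edges form a chain, and the tree is the hyperpath.
-/

section Apolar

open MvPolynomial

variable {σ τ R : Type*} [CommSemiring R]

/-- The apolar pairing `⟨p, f⟩ = ∑_M M! p_M f_M` of polynomials, which evaluates at `0` the
result of applying to `f` the constant-coefficient differential operator with symbol `p`. -/
noncomputable def apolar : MvPolynomial σ R →ₗ[R] MvPolynomial σ R →ₗ[R] R :=
  (basisMonomials σ R).constr R fun M => (M.prod fun _ n => (n.factorial : R)) • lcoeff R M

theorem apolar_monomial (M : σ →₀ ℕ) (c : R) (f : MvPolynomial σ R) :
    apolar (monomial M c) f = c * ((M.prod fun _ n => (n.factorial : R)) * coeff M f) := by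
  have h : (monomial M c : MvPolynomial σ R) = c • basisMonomials σ R M := by
    simp [smul_monomial]
  rw [h, map_smul, apolar, Module.Basis.constr_basis]
  simp

theorem apolar_one (f : MvPolynomial σ R) : apolar 1 f = constantCoeff f := by
  rw [show (1 : MvPolynomial σ R) = monomial 0 1 from rfl, apolar_monomial]
  simp [constantCoeff_eq]

theorem prod_factorial_add_single (M : σ →₀ ℕ) (s : σ) :
    ((M + Finsupp.single s 1).prod fun _ n => (n.factorial : R))
      = (M s + 1) * M.prod fun _ n => (n.factorial : R) := by
  rw [← Finsupp.mul_prod_erase' M s _ (by simp), ← Finsupp.mul_prod_erase' (M + _) s _ (by simp)]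
  simp [Finsupp.erase_add, Nat.factorial_succ, mul_assoc]

theorem apolar_X_mul (s : σ) (p f : MvPolynomial σ R) :
    apolar (X s * p) f = apolar p (pderiv s f) := by
  induction p using MvPolynomial.induction_on' with
  | add p q hp hq => simp only [mul_add, map_add, LinearMap.add_apply, hp, hq]
  | monomial M a =>
    rw [X, monomial_mul, one_mul, apolar_monomial, apolar_monomial, coeff_pderiv, add_comm,
      prod_factorial_add_single]
    ring

theorem apolar_rename {e : σ → τ} (he : Function.Injective e) (p f : MvPolynomial σ R) :
    apolar (rename e p) (rename e f) = apolar p f := by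
  induction p using MvPolynomial.induction_on' with
  | add p q hp hq => simp only [map_add, LinearMap.add_apply, hp, hq]
  | monomial M a =>
    rw [rename_monomial, apolar_monomial, apolar_monomial, coeff_rename_mapDomain e he,
      Finsupp.prod_mapDomain_index_inj he]

/-- The operator `D` on polynomials is the differential operator with symbol `P`, that is, `D` is
adjoint to multiplication by `P` under the apolar pairing. -/
def IsSymbol (D : Module.End R (MvPolynomial σ R)) (P : MvPolynomial σ R) : Prop :=
  ∀ p, apolar (P * p) = apolar p ∘ₗ D

namespace IsSymbol

variable {D D' : Module.End R (MvPolynomial σ R)} {P P' : MvPolynomial σ R}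

theorem pderiv (s : σ) :
    IsSymbol ((MvPolynomial.pderiv (R := R) s).toLinearMap : Module.End R (MvPolynomial σ R))
      (X s) :=
  fun p => LinearMap.ext (apolar_X_mul s p)

theorem one : IsSymbol (1 : Module.End R (MvPolynomial σ R)) 1 :=
  fun p => by rw [one_mul]; rfl

theorem mul (h : IsSymbol D P) (h' : IsSymbol D' P') : IsSymbol (D * D') (P * P') :=
  fun p => by rw [mul_comm P, mul_assoc, h', h]; rfl

theorem smul (c : R) (h : IsSymbol D P) : IsSymbol (c • D) (c • P) :=
  fun p => by rw [smul_mul_assoc, map_smul, h, LinearMap.comp_smul]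

theorem sum {J : Type*} (s : Finset J) {D : J → Module.End R (MvPolynomial σ R)}
    {P : J → MvPolynomial σ R} (h : ∀ j ∈ s, IsSymbol (D j) (P j)) :
    IsSymbol (∑ j ∈ s, D j) (∑ j ∈ s, P j) := fun p => LinearMap.ext fun f => by
  simp only [Finset.sum_mul, map_sum, LinearMap.sum_apply, LinearMap.comp_apply]
  exact Finset.sum_congr rfl fun j hj => DFunLike.congr_fun (h j hj p) f

theorem pow (h : IsSymbol D P) (n : ℕ) : IsSymbol (D ^ n) (P ^ n) := by
  induction n with
  | zero => simpa using one
  | succ n ih => rw [pow_succ, pow_succ]; exact ih.mul h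

theorem ofFn_prod {n : ℕ} {D : Fin n → Module.End R (MvPolynomial σ R)}
    {P : Fin n → MvPolynomial σ R} (h : ∀ j, IsSymbol (D j) (P j)) :
    IsSymbol (List.ofFn D).prod (∏ j, P j) := by
  induction n with
  | zero => simpa using one
  | succ n ih =>
    rw [List.ofFn_succ, List.prod_cons, Fin.prod_univ_succ]
    exact (h 0).mul (ih fun j => h j.succ)

theorem noncommProd {J : Type*} (s : Finset J) {D : J → Module.End R (MvPolynomial σ R)}
    {P : J → MvPolynomial σ R} (comm) (h : ∀ j ∈ s, IsSymbol (D j) (P j)) :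
    IsSymbol (s.noncommProd D comm) (∏ j ∈ s, P j) := by
  induction s using Finset.cons_induction with
  | empty => simpa using one
  | cons a s ha ih =>
    rw [Finset.noncommProd_cons, Finset.prod_cons]
    exact (h a (by simp)).mul (ih _ fun j hj => h j (by simp [hj]))

theorem constantCoeff_apply (h : IsSymbol D P) (f : MvPolynomial σ R) :
    constantCoeff (D f) = apolar P f := by
  rw [← apolar_one, ← mul_one P, h, LinearMap.comp_apply]

end IsSymbol

end Apolar

namespace HTensor

open MvPolynomial

section Trace

variable {k : ℕ} {ι κ R : Type*} [Fintype ι] [Fintype κ]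

/-- The polynomial `∑_x 𝓐_{ix} a_{i i₂} ⋯ a_{i i_k}`, the symbol of `rowOp`. -/
noncomputable def rowPoly [CommSemiring R] (A : HTensor k ι R) (i : ι) : MvPolynomial (ι × ι) R :=
  open Classical in ∑ x : Fin (k - 1) → ι, A i x • ∏ j, X (i, x j)

/-- The trace of the `N`-th power of the matrix of the indeterminates `a_{ij}`. -/
noncomputable def powTrace (ι R : Type*) [Fintype ι] [CommSemiring R] (N : ℕ) :
    MvPolynomial (ι × ι) R :=
  open Classical in Matrix.trace (Matrix.mvPolynomialX ι ι R ^ N)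

theorem isSymbol_rowOp [Field R] (A : HTensor k ι R) (i : ι) :
    IsSymbol (rowOp A i) (rowPoly A i) :=
  IsSymbol.sum _ fun _ _ => (IsSymbol.ofFn_prod fun _ => IsSymbol.pderiv _).smul _

theorem trace_eq_apolar [DecidableEq ι] [Field R] (d : ℕ) (A : HTensor k ι R) :
    trace d A = ((k : R) - 1) ^ (Fintype.card ι - 1) *
      ∑ δ ∈ Finset.piAntidiag (Finset.univ : Finset ι) d,
        (∏ i, ((Nat.factorial (δ i * (k - 1)) : R)⁻¹)) *
          apolar (∏ i, rowPoly A i ^ δ i) (powTrace ι R (d * (k - 1))) := by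
  rw [trace]
  congr 1
  refine Finset.sum_congr (by congr!) fun δ _ => ?_
  have h := IsSymbol.noncommProd Finset.univ (rowOp_pairwise A δ)
    (fun i _ => ((isSymbol_rowOp A i).pow (δ i)).smul ((Nat.factorial (δ i * (k - 1)) : R)⁻¹))
  refine (h.constantCoeff_apply _).trans ?_
  rw [Finset.prod_smul, map_smul, LinearMap.smul_apply, smul_eq_mul, powTrace]

theorem rename_mvPolynomialX_pow [DecidableEq ι] [DecidableEq κ] [CommSemiring R] (e : ι ≃ κ)
    (N : ℕ) (u v : ι) :
    rename (Prod.map e e) ((Matrix.mvPolynomialX ι ι R ^ N) u v)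
      = (Matrix.mvPolynomialX κ κ R ^ N) (e u) (e v) := by
  induction N generalizing u v with
  | zero => simp [Matrix.one_apply, apply_ite (rename _)]
  | succ N ih =>
    rw [pow_succ, pow_succ, Matrix.mul_apply, Matrix.mul_apply, map_sum, ← e.sum_comp]
    exact Finset.sum_congr rfl fun w _ => by rw [map_mul, ih]; simp [Matrix.mvPolynomialX]

theorem rename_powTrace [CommSemiring R] (e : ι ≃ κ) (N : ℕ) :
    rename (Prod.map e e) (powTrace ι R N) = powTrace κ R N := by
  classical
  simp only [powTrace, Matrix.trace, Matrix.diag, map_sum]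
  rw [← e.sum_comp]
  exact Finset.sum_congr rfl fun w _ => rename_mvPolynomialX_pow e N w w

theorem rename_rowPoly [CommSemiring R] (e : ι ≃ κ) {A : HTensor k ι R} {B : HTensor k κ R}
    (h : ∀ i x, A i x = B (e i) (e ∘ x)) (i : ι) :
    rename (Prod.map e e) (rowPoly A i) = rowPoly B (e i) := by
  rw [rowPoly, rowPoly, map_sum, ← (Equiv.arrowCongr (Equiv.refl (Fin (k - 1))) e).sum_comp]
  refine Finset.sum_congr (by congr!) fun x _ => ?_
  rw [map_smul, map_prod]
  simp [h, Function.comp_def, Equiv.arrowCongr]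

theorem sum_piAntidiag_comp_equiv [DecidableEq ι] [DecidableEq κ] {M : Type*} [AddCommMonoid M]
    (e : ι ≃ κ) (d : ℕ) (F : (ι → ℕ) → M) :
    ∑ δ ∈ Finset.piAntidiag Finset.univ d, F (δ ∘ e) =
      ∑ δ ∈ Finset.piAntidiag Finset.univ d, F δ := by
  refine Finset.sum_equiv (e.arrowCongr (Equiv.refl ℕ)).symm (fun δ => ?_) fun δ _ => rfl
  simp [Equiv.arrowCongr, e.sum_comp]

theorem trace_reindex [Field R] (e : ι ≃ κ) (d : ℕ) {A : HTensor k ι R} {B : HTensor k κ R}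
    (h : ∀ i x, A i x = B (e i) (e ∘ x)) : trace d A = trace d B := by
  classical
  rw [trace_eq_apolar, trace_eq_apolar, Fintype.card_congr e, ← sum_piAntidiag_comp_equiv e]
  congr 1
  refine Finset.sum_congr rfl fun δ _ => ?_
  rw [← rename_powTrace e, ← e.prod_comp, ← e.prod_comp (fun i => rowPoly B i ^ _)]
  simp only [Function.comp_apply, ← rename_rowPoly e h, ← map_pow, ← map_prod]
  rw [apolar_rename (e.injective.prodMap e.injective)]

theorem trace_zero [Field R] (A : HTensor k ι R) :
    trace 0 A = ((k : R) - 1) ^ (Fintype.card ι - 1) * Fintype.card ι := by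
  classical
  rw [trace_eq_apolar, Finset.piAntidiag_zero, Finset.sum_singleton]
  simp [powTrace, apolar_one]

end Trace

/-! ### Walks and powers of the generic matrix -/

/-- `M` is the multiset of arcs of some walk from `u` to `v` in the complete digraph with loops. -/
inductive IsWalk {ι : Type*} : (ι × ι →₀ ℕ) → ι → ι → Prop
  | nil (u : ι) : IsWalk 0 u u
  | snoc {M : ι × ι →₀ ℕ} {u w : ι} (h : IsWalk M u w) (v : ι) :
      IsWalk (M + Finsupp.single (w, v) 1) u v

namespace IsWalk

variable {ι : Type*} {M M' : ι × ι →₀ ℕ} {u v w : ι}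

theorem arc (u v : ι) : IsWalk (Finsupp.single (u, v) 1) u v := by
  simpa using (nil u).snoc v

theorem append (h : IsWalk M u v) (h' : IsWalk M' v w) : IsWalk (M + M') u w := by
  induction h' with
  | nil => simpa using h
  | snoc _ x ih => rw [← add_assoc]; exact (ih h).snoc x

theorem loops (u : ι) (n : ℕ) : IsWalk (Finsupp.single (u, u) n) u u := by
  induction n with
  | zero => simpa using nil u
  | succ n ih => rw [Finsupp.single_add]; exact ih.snoc u

theorem sum {κ : Type*} {s : Finset κ} {M : κ → ι × ι →₀ ℕ} (h : ∀ x ∈ s, IsWalk (M x) u u) :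
    IsWalk (∑ x ∈ s, M x) u u :=
  Finset.sum_induction _ (IsWalk · u u) (fun _ _ => append) (nil u) h

theorem sum_source_add_eq [Fintype ι] [DecidableEq ι] (h : IsWalk M u v) (w : ι) :
    (∑ x, M (w, x)) + (if w = v then 1 else 0) = (∑ x, M (x, w)) + if w = u then 1 else 0 := by
  induction h with
  | nil => simp
  | @snoc M u z _ v ih =>
    have hout : (∑ x, if z = w ∧ v = x then 1 else 0) = if w = z then 1 else 0 := by
      by_cases hz : z = w <;> simp [hz, eq_comm (a := w)]
    have hin : (∑ x, if z = x ∧ v = w then 1 else 0) = if w = v then 1 else 0 := by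
      by_cases hz : v = w <;> simp [hz, eq_comm (a := w)]
    simp only [Finsupp.add_apply, Finset.sum_add_distrib, Finsupp.single_apply, Prod.mk.injEq,
      hout, hin]
    omega

theorem sum_source_eq_sum_target [Fintype ι] (h : IsWalk M u u) (w : ι) :
    ∑ x, M (w, x) = ∑ x, M (x, w) := by
  classical simpa using h.sum_source_add_eq w

theorem mem_of_closed (h : IsWalk M u v) {C : Set ι}
    (hC : ∀ x y, M (x, y) ≠ 0 → (x ∈ C ↔ y ∈ C)) (hu : u ∈ C) :
    v ∈ C ∧ ∀ x y, M (x, y) ≠ 0 → x ∈ C := by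
  induction h with
  | nil => simpa using hu
  | @snoc M u z _ v ih =>
    obtain ⟨hz, hM⟩ := ih (fun x y hxy => hC x y (by simp [hxy])) hu
    refine ⟨(hC z v (by simp)).1 hz, fun x y hxy => ?_⟩
    by_cases hxy' : M (x, y) = 0
    · obtain ⟨rfl, -⟩ : z = x ∧ v = y := by
        classical simpa [hxy', Finsupp.single_apply] using hxy
      exact hz
    · exact hM x y hxy'

theorem forall_mem_or_forall_notMem (h : IsWalk M u v) {C : Set ι}
    (hC : ∀ x y, M (x, y) ≠ 0 → (x ∈ C ↔ y ∈ C)) :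
    (∀ x y, M (x, y) ≠ 0 → x ∈ C) ∨ ∀ x y, M (x, y) ≠ 0 → x ∉ C := by
  by_cases hu : u ∈ C
  · exact .inl (h.mem_of_closed hC hu).2
  · exact .inr (h.mem_of_closed (C := Cᶜ) (fun x y hxy => (hC x y hxy).not) hu).2

end IsWalk

section GenericMatrix

variable {ι R : Type*} [Fintype ι] [CommSemiring R]

section DecidableEq

variable [DecidableEq ι]

theorem coeff_mvPolynomialX_pow_succ (M : ι × ι →₀ ℕ) (N : ℕ) (u v : ι) :
    coeff M ((Matrix.mvPolynomialX ι ι R ^ (N + 1)) u v) =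
      ∑ w, if (w, v) ∈ M.support then
        coeff (M - Finsupp.single (w, v) 1) ((Matrix.mvPolynomialX ι ι R ^ N) u w) else 0 := by
  rw [pow_succ, Matrix.mul_apply, coeff_sum]
  exact Finset.sum_congr rfl fun w _ => by rw [Matrix.mvPolynomialX_apply, coeff_mul_X']

theorem isWalk_of_coeff_mvPolynomialX_pow_ne_zero {M : ι × ι →₀ ℕ} {N : ℕ} {u v : ι}
    (h : coeff M ((Matrix.mvPolynomialX ι ι R ^ N) u v) ≠ 0) : IsWalk M u v := by
  induction N generalizing M v with
  | zero =>
    rw [pow_zero, Matrix.one_apply] at h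
    split_ifs at h with huv
    · obtain rfl : M = 0 := by
        by_contra hM
        exact h (by rw [coeff_one, if_neg (Ne.symm hM)])
      exact huv ▸ .nil u
    · simp at h
  | succ N ih =>
    rw [coeff_mvPolynomialX_pow_succ] at h
    obtain ⟨w, -, hw⟩ := Finset.exists_ne_zero_of_sum_ne_zero h
    obtain ⟨hs, hw⟩ := ite_ne_right_iff.1 hw
    have hle : Finsupp.single (w, v) 1 ≤ M := by
      rwa [Finsupp.single_le_iff, Nat.one_le_iff_ne_zero, ← Finsupp.mem_support_iff]
    exact tsub_add_cancel_of_le hle ▸ (ih hw).snoc v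

theorem coeff_mvPolynomialX_pow_loops (i u v : ι) {N : ℕ} (hN : N ≠ 0) :
    coeff (Finsupp.single (i, i) N) ((Matrix.mvPolynomialX ι ι R ^ N) u v)
      = if u = i ∧ v = i then 1 else 0 := by
  induction N, Nat.one_le_iff_ne_zero.2 hN using Nat.le_induction generalizing v with
  | base =>
    rw [pow_one, Matrix.mvPolynomialX_apply, coeff_X]
    simp [Finsupp.single_left_inj]
  | succ N _ ih =>
    rw [coeff_mvPolynomialX_pow_succ, Finset.sum_eq_single i (by simp +contextual [eq_comm])
      (by simp)]
    by_cases hv : v = i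
    · subst hv
      rw [if_pos (by simp), Finsupp.single_add _ N 1, add_tsub_cancel_right, ih _ (by omega)]
    · rw [if_neg (by simp [Ne.symm hv]), if_neg (by simp [hv])]

section Ordered

variable [PartialOrder R] [IsStrictOrderedRing R]

theorem coeff_mvPolynomialX_pow_nonneg (M : ι × ι →₀ ℕ) (N : ℕ) (u v : ι) :
    0 ≤ coeff M ((Matrix.mvPolynomialX ι ι R ^ N) u v) := by
  induction N generalizing M v with
  | zero =>
    rw [pow_zero, Matrix.one_apply]
    split_ifs
    · rw [coeff_one]; split_ifs <;> simp
    · simp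
  | succ N ih =>
    rw [coeff_mvPolynomialX_pow_succ]
    refine Finset.sum_nonneg fun w _ => ?_
    split_ifs
    exacts [ih _ _, le_rfl]

theorem IsWalk.coeff_mvPolynomialX_pow_pos {M : ι × ι →₀ ℕ} {u v : ι} (h : IsWalk M u v) :
    0 < coeff M ((Matrix.mvPolynomialX ι ι R ^ M.degree) u v) := by
  induction h with
  | nil => simp
  | @snoc M u z _ v ih =>
    rw [map_add, Finsupp.degree_single, coeff_mvPolynomialX_pow_succ]
    refine Finset.sum_pos' (fun x _ => ?_) ⟨z, Finset.mem_univ z, ?_⟩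
    · split_ifs
      exacts [coeff_mvPolynomialX_pow_nonneg _ _ _ _, le_rfl]
    · rwa [if_pos (by simp), add_tsub_cancel_right]

end Ordered

end DecidableEq

theorem coeff_powTrace [DecidableEq ι] (M : ι × ι →₀ ℕ) (N : ℕ) :
    coeff M (powTrace ι R N) = ∑ u, coeff M ((Matrix.mvPolynomialX ι ι R ^ N) u u) := by
  simp only [powTrace, Matrix.trace, Matrix.diag, coeff_sum]
  exact Finset.sum_congr rfl fun u _ => by congr!

theorem exists_isWalk_of_coeff_powTrace_ne_zero {M : ι × ι →₀ ℕ} {N : ℕ}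
    (h : coeff M (powTrace ι R N) ≠ 0) : ∃ u, IsWalk M u u := by
  classical
  rw [coeff_powTrace] at h
  obtain ⟨u, -, hu⟩ := Finset.exists_ne_zero_of_sum_ne_zero h
  exact ⟨u, isWalk_of_coeff_mvPolynomialX_pow_ne_zero hu⟩

theorem coeff_powTrace_loops (i : ι) {N : ℕ} (hN : N ≠ 0) :
    coeff (Finsupp.single (i, i) N) (powTrace ι R N) = 1 := by
  classical
  simp [coeff_powTrace, coeff_mvPolynomialX_pow_loops i _ _ hN]

theorem IsWalk.coeff_powTrace_pos [PartialOrder R] [IsStrictOrderedRing R] {M : ι × ι →₀ ℕ}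
    {u : ι} (h : IsWalk M u u) : 0 < coeff M (powTrace ι R M.degree) := by
  classical
  rw [coeff_powTrace]
  exact Finset.sum_pos' (fun x _ => coeff_mvPolynomialX_pow_nonneg M M.degree x x)
    ⟨u, Finset.mem_univ u, h.coeff_mvPolynomialX_pow_pos⟩

end GenericMatrix

/-- The arcs of the complete digraph on `S`, together with `c u` loops at each `u ∈ S`. -/
noncomputable def completeArcs {ι : Type*} [DecidableEq ι] (S : Finset ι) (c : ι → ℕ) :
    ι × ι →₀ ℕ :=
  ∑ u ∈ S, ∑ v ∈ S, Finsupp.single (u, v) (if u = v then c u else 1)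

section CompleteArcs

variable {ι : Type*} [DecidableEq ι] {S : Finset ι} {r z : ι}

theorem completeArcs_insert (hz : z ∉ S) (c : ι → ℕ) :
    completeArcs (insert z S) c = completeArcs S c + Finsupp.single (z, z) (c z) +
      ∑ u ∈ S, (Finsupp.single (z, u) 1 + Finsupp.single (u, z) 1) := by
  have hout : ∑ v ∈ S, Finsupp.single (z, v) (if z = v then c z else 1)
      = ∑ v ∈ S, Finsupp.single (z, v) 1 :=
    Finset.sum_congr rfl fun v hv => by rw [if_neg]; rintro rfl; exact hz hv
  have hin : ∑ u ∈ S, Finsupp.single (u, z) (if u = z then c u else 1)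
      = ∑ u ∈ S, Finsupp.single (u, z) 1 :=
    Finset.sum_congr rfl fun v hv => by rw [if_neg]; rintro rfl; exact hz hv
  simp only [completeArcs, Finset.sum_insert hz, Finset.sum_add_distrib, hout, hin, if_true]
  abel

theorem isWalk_completeArcs_insert (hr : r ∉ S) (c : ι → ℕ) :
    IsWalk (completeArcs (insert r S) c) r r := by
  induction S using Finset.induction_on with
  | empty => simpa [completeArcs] using IsWalk.loops r (c r)
  | insert z S hz ih =>
    rw [Finset.mem_insert, not_or] at hr
    have hz' : z ∉ insert r S := by simp [hz, Ne.symm hr.1]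
    -- The walk goes to the new vertex `z` and back; at `z` it visits each vertex of `S` once.
    have hdetour : IsWalk (Finsupp.single (z, z) (c z) +
        ∑ u ∈ S, (Finsupp.single (z, u) 1 + Finsupp.single (u, z) 1)) z z :=
      (IsWalk.loops z _).append (IsWalk.sum fun u _ => (IsWalk.arc z u).append (IsWalk.arc u z))
    have hwalk := (ih hr.2).append (((IsWalk.arc r z).append hdetour).append (IsWalk.arc z r))
    rw [Finset.insert_comm, completeArcs_insert hz', Finset.sum_insert hr.2]
    convert hwalk using 1
    abel

theorem isWalk_completeArcs (hr : r ∈ S) (c : ι → ℕ) : IsWalk (completeArcs S c) r r := by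
  rw [← Finset.insert_erase hr]
  exact isWalk_completeArcs_insert (Finset.notMem_erase r S) c

end CompleteArcs

/-! ### The tensor of a finite family of edges -/

/-- The number of members of `E` that contain `v`. -/
def edgeDegree {ι : Type*} [DecidableEq ι] (E : Finset (Finset ι)) (v : ι) : ℕ :=
  (E.filter (v ∈ ·)).card

/-- The tensor `α 𝓓 + (1 - α) 𝓐` of the `k`-uniform hypergraph on `ι` with the edges `E`. -/
def edgeTensor {ι R : Type*} [DecidableEq ι] [Field R] (k : ℕ) (E : Finset (Finset ι)) (α : R) :
    HTensor k ι R := fun i x =>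
  α * (if ∀ j, x j = i then (edgeDegree E i : R) else 0) +
    (1 - α) * (if insert i (Finset.univ.image x) ∈ E then 1 / (Nat.factorial (k - 1) : R) else 0)

section RowTerms

variable {ι : Type*} [DecidableEq ι] {R : Type*} {k : ℕ} {E : Finset (Finset ι)}

/-- Labels of the terms of the `i`-th row polynomial of `edgeTensor k E α`: `none` stands for the
diagonal term, and `some e` for the edge `e` through `i`. -/
def rowTerms (E : Finset (Finset ι)) (i : ι) : Finset (Option (Finset ι)) :=
  Finset.insertNone (E.filter (i ∈ ·))

/-- The exponent of a term of the `i`-th row polynomial, as a multiset of arcs leaving `i`. -/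
noncomputable def termArcs (k : ℕ) (i : ι) : Option (Finset ι) → ι × ι →₀ ℕ
  | none => Finsupp.single (i, i) (k - 1)
  | some e => ∑ j ∈ e.erase i, Finsupp.single (i, j) 1

/-- The coefficient of a term of the `i`-th row polynomial of `edgeTensor k E α`. -/
def termCoeff [Ring R] (E : Finset (Finset ι)) (α : R) (i : ι) : Option (Finset ι) → R
  | none => α * edgeDegree E i
  | some _ => 1 - α

theorem termArcs_none_apply (i x y : ι) :
    termArcs k i none (x, y) = if i = x ∧ x = y then k - 1 else 0 := by
  rw [termArcs, Finsupp.single_apply]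
  exact if_congr (by grind) rfl rfl

theorem termArcs_some_apply (i x y : ι) (e : Finset ι) :
    termArcs k i (some e) (x, y) = if i = x ∧ y ∈ e.erase x then 1 else 0 := by
  rw [termArcs, Finsupp.finsetSum_apply]
  simp only [Finsupp.single_apply, Prod.mk.injEq]
  by_cases h : i = x
  · subst h
    simp
  · simp [h]

section Tuples

variable {e : Finset ι} {i : ι}

theorem image_eq_erase_of_insert_image_eq (he : e.card = k) {x : Fin (k - 1) → ι}
    (hx : insert i (Finset.univ.image x) = e) : Finset.univ.image x = e.erase i := by
  have hi : i ∈ e := hx ▸ Finset.mem_insert_self i _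
  refine (Finset.eq_of_subset_of_card_le (hx ▸ Finset.erase_insert_subset _ _) ?_).symm
  simpa [Finset.card_erase_of_mem hi, he] using Finset.card_image_le (s := Finset.univ) (f := x)

theorem injective_of_insert_image_eq (he : e.card = k) {x : Fin (k - 1) → ι}
    (hx : insert i (Finset.univ.image x) = e) : Function.Injective x := by
  have hi : i ∈ e := hx ▸ Finset.mem_insert_self i _
  have hcard : (Finset.univ.image x).card = (Finset.univ : Finset (Fin (k - 1))).card := by
    simp [image_eq_erase_of_insert_image_eq he hx, Finset.card_erase_of_mem hi, he]
  simpa using Finset.card_image_iff.1 hcard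

theorem card_filter_insert_image_eq [Fintype ι] (he : e.card = k) (hi : i ∈ e) :
    (Finset.univ.filter fun x : Fin (k - 1) → ι => insert i (Finset.univ.image x) = e).card
      = (k - 1).factorial := by
  have hcard : Fintype.card (Fin (k - 1)) = Fintype.card (e.erase i) := by
    rw [Fintype.card_fin, Fintype.card_coe, Finset.card_erase_of_mem hi, he]
  have hfactorial : (k - 1).factorial = (Finset.univ : Finset (Fin (k - 1) ≃ e.erase i)).card := by
    rw [Finset.card_univ, Fintype.card_equiv (Fintype.equivOfCardEq hcard), Fintype.card_fin]
  rw [hfactorial]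
  symm
  refine Finset.card_bij (fun g _ j => (g j : ι)) (fun g _ => ?_) (fun g _ g' _ h => ?_)
    fun x hx => ?_
  · have himage : Finset.univ.image (fun j => (g j : ι)) = e.erase i := by
      ext v
      simp only [Finset.mem_image, Finset.mem_univ, true_and]
      exact ⟨fun ⟨j, hj⟩ => hj ▸ (g j).2, fun hv => ⟨g.symm ⟨v, hv⟩, by simp⟩⟩
    simp [himage, Finset.insert_erase hi]
  · exact Equiv.ext fun j => Subtype.ext (congrFun h j)
  · have hx := (Finset.mem_filter.1 hx).2
    have hmem (j) : x j ∈ e.erase i := by simp [← image_eq_erase_of_insert_image_eq he hx]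
    have hinj : Function.Injective fun j => (⟨x j, hmem j⟩ : e.erase i) :=
      fun j j' h => injective_of_insert_image_eq he hx (congrArg Subtype.val h)
    exact ⟨.ofBijective _ ((Fintype.bijective_iff_injective_and_card _).2 ⟨hinj, hcard⟩),
      Finset.mem_univ _, rfl⟩

theorem prod_X_of_insert_image_eq [CommSemiring R] (he : e.card = k) {x : Fin (k - 1) → ι}
    (hx : insert i (Finset.univ.image x) = e) :
    (∏ j, X (i, x j) : MvPolynomial (ι × ι) R) = monomial (termArcs k i (some e)) 1 := by
  have hmonomial := monomial_sum_prod (e.erase i) (fun v => Finsupp.single (i, v) 1)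
    (fun _ => (1 : R))
  rw [Finset.prod_const_one] at hmonomial
  rw [termArcs, hmonomial, ← image_eq_erase_of_insert_image_eq he hx,
    Finset.prod_image (injective_of_insert_image_eq he hx).injOn]
  rfl

end Tuples

variable [Fintype ι]

theorem sum_adjacency_smul_prod_X [Field R] [CharZero R] (hE : ∀ e ∈ E, e.card = k) (i : ι) :
    (∑ x : Fin (k - 1) → ι, (if insert i (Finset.univ.image x) ∈ E then
        1 / (Nat.factorial (k - 1) : R) else 0) • ∏ j, X (i, x j) : MvPolynomial (ι × ι) R) =
      ∑ e ∈ E with i ∈ e, monomial (termArcs k i (some e)) 1 := by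
  have hfactorial : (Nat.factorial (k - 1) : R) ≠ 0 := by exact_mod_cast Nat.factorial_ne_zero _
  simp only [ite_smul, zero_smul]
  rw [← Finset.sum_filter, ← Finset.sum_fiberwise_of_maps_to
    (g := fun x => insert i (Finset.univ.image x)) (t := E.filter (i ∈ ·))
    (fun x hx => by simpa using (Finset.mem_filter.1 hx).2)]
  refine Finset.sum_congr rfl fun e he => ?_
  obtain ⟨heE, hie⟩ := Finset.mem_filter.1 he
  have hfilter : ((Finset.univ.filter fun x : Fin (k - 1) → ι =>
      insert i (Finset.univ.image x) ∈ E).filter fun x => insert i (Finset.univ.image x) = e) =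
      Finset.univ.filter fun x => insert i (Finset.univ.image x) = e := by
    grind
  rw [hfilter, Finset.sum_congr rfl fun x hx => by
    rw [prod_X_of_insert_image_eq (hE e heE) (Finset.mem_filter.1 hx).2], Finset.sum_const,
    card_filter_insert_image_eq (hE e heE) hie, ← Nat.cast_smul_eq_nsmul R, smul_smul,
    mul_one_div_cancel hfactorial, one_smul]

theorem sum_diagonal_smul_prod_X [CommSemiring R] (i : ι) (c : R) :
    (∑ x : Fin (k - 1) → ι, (if ∀ j, x j = i then c else 0) • ∏ j, X (i, x j) :
      MvPolynomial (ι × ι) R) = monomial (termArcs k i none) c := by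
  rw [Finset.sum_eq_single (fun _ => i) (fun x _ hx => ?_) (by simp)]
  · simp [termArcs, X_pow_eq_monomial, smul_monomial]
  · rw [if_neg fun h => hx (funext h), zero_smul]

theorem rowPoly_edgeTensor [Field R] [CharZero R] (hE : ∀ e ∈ E, e.card = k) (α : R) (i : ι) :
    rowPoly (edgeTensor k E α) i =
      ∑ o ∈ rowTerms E i, monomial (termArcs k i o) (termCoeff E α i o) := by
  have hrow : rowPoly (edgeTensor k E α) i =
      α • (∑ x : Fin (k - 1) → ι, (if ∀ j, x j = i then (edgeDegree E i : R) else 0) •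
        ∏ j, X (i, x j)) +
      (1 - α) • ∑ x : Fin (k - 1) → ι, (if insert i (Finset.univ.image x) ∈ E then
        1 / (Nat.factorial (k - 1) : R) else 0) • ∏ j, X (i, x j) := by
    rw [rowPoly, Finset.smul_sum, Finset.smul_sum, ← Finset.sum_add_distrib]
    exact Finset.sum_congr (by congr!) fun x _ => by rw [edgeTensor, add_smul, mul_smul, mul_smul]
  rw [hrow, sum_diagonal_smul_prod_X, sum_adjacency_smul_prod_X hE, rowTerms,
    Finset.sum_insertNone, Finset.smul_sum]
  simp [termCoeff, smul_monomial]

end RowTerms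

section Choices

variable {ι : Type*} [DecidableEq ι] {R : Type*} {k : ℕ} {E : Finset (Finset ι)}

/-- Every incident pair `v ∈ e` is a cut: some set meets `e` in `v` only, and contains or avoids
each of the other edges. -/
def HasCuts (E : Finset (Finset ι)) : Prop :=
  ∀ e ∈ E, ∀ v ∈ e, ∃ C : Finset ι, C ∩ e = {v} ∧ ∀ f ∈ E, f ≠ e → f ⊆ C ∨ Disjoint f C

-- Summing the hypothesis over the cut set `C` of the pair `v ∈ e`, the other edges cancel.
theorem HasCuts.mul_eq_sum (hcut : HasCuts E) (hE : ∀ e ∈ E, e.card = k)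
    {b : ι → Finset ι → ℕ}
    (hb : ∀ w, ∑ e ∈ E with w ∈ e, k * b w e = ∑ e ∈ E with w ∈ e, ∑ x ∈ e, b x e)
    {e : Finset ι} (he : e ∈ E) {v : ι} (hv : v ∈ e) : k * b v e = ∑ x ∈ e, b x e := by
  obtain ⟨C, hCe, hC⟩ := hcut e he v hv
  have hswap (F : ι → Finset ι → ℕ) :
      ∑ w ∈ C, ∑ f ∈ E with w ∈ f, F w f = ∑ f ∈ E, ∑ w ∈ C ∩ f, F w f :=
    Finset.sum_comm' (by simp; tauto)
  have hsum : ∑ f ∈ E, ∑ w ∈ C ∩ f, k * b w f = ∑ f ∈ E, ∑ _w ∈ C ∩ f, ∑ x ∈ f, b x f := by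
    rw [← hswap, ← hswap]
    exact Finset.sum_congr rfl fun w _ => hb w
  have hother : ∀ f ∈ E.erase e,
      ∑ w ∈ C ∩ f, k * b w f = ∑ _w ∈ C ∩ f, ∑ x ∈ f, b x f := fun f hf => by
    obtain ⟨hfe, hf⟩ := Finset.mem_erase.1 hf
    rcases hC f hf hfe with h | h
    · rw [Finset.inter_eq_right.2 h, ← Finset.mul_sum, Finset.sum_const, hE f hf, smul_eq_mul]
    · rw [Finset.disjoint_iff_inter_eq_empty.1 h.symm, Finset.sum_empty, Finset.sum_empty]
  rw [← Finset.add_sum_erase _ _ he, ← Finset.add_sum_erase _ _ he,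
    Finset.sum_congr rfl hother, hCe] at hsum
  simpa using hsum

variable [Fintype ι]

/-- The multiplicities `a i o` with which the terms `o` of the `i`-th row polynomials can be
multiplied together so that the `i`-th row polynomial supplies `δ i` factors. -/
def choices (E : Finset (Finset ι)) (δ : ι → ℕ) : Finset (ι → Option (Finset ι) → ℕ) :=
  Fintype.piFinset fun i => Finset.piAntidiag (rowTerms E i) (δ i)

/-- The exponent of the monomial selected by a choice, as a multiset of arcs. -/
noncomputable def choiceArcs (k : ℕ) (E : Finset (Finset ι)) (a : ι → Option (Finset ι) → ℕ) :
    ι × ι →₀ ℕ :=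
  ∑ i, ∑ o ∈ rowTerms E i, a i o • termArcs k i o

/-- The coefficient with which the monomial selected by a choice occurs. -/
def choiceCoeff [CommRing R] (E : Finset (Finset ι)) (α : R) (a : ι → Option (Finset ι) → ℕ) : R :=
  ∏ i, ((Nat.multinomial (rowTerms E i) (a i) : R) *
    ∏ o ∈ rowTerms E i, termCoeff E α i o ^ a i o)

theorem prod_pow_sum_monomial [CommRing R] (k : ℕ) (α : R) (δ : ι → ℕ) :
    ∏ i, (∑ o ∈ rowTerms E i, monomial (termArcs k i o) (termCoeff E α i o)) ^ δ i =
      ∑ a ∈ choices E δ, monomial (choiceArcs k E a) (choiceCoeff E α a) := by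
  have hrow (i : ι) :
      (∑ o ∈ rowTerms E i, monomial (termArcs k i o) (termCoeff E α i o)) ^ δ i =
      ∑ a ∈ Finset.piAntidiag (rowTerms E i) (δ i),
        monomial (∑ o ∈ rowTerms E i, a o • termArcs k i o)
          ((Nat.multinomial (rowTerms E i) a : R) *
            ∏ o ∈ rowTerms E i, termCoeff E α i o ^ a o) := by
    rw [Finset.sum_pow_eq_sum_piAntidiag]
    refine Finset.sum_congr rfl fun a _ => ?_
    simp_rw [monomial_pow, ← monomial_sum_prod]
    rw [← nsmul_eq_mul, ← nsmul_eq_mul, ← map_nsmul]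
  simp_rw [hrow]
  rw [Finset.prod_univ_sum]
  exact Finset.sum_congr rfl fun a _ => (monomial_sum_prod _ _ _).symm

theorem apolar_prod_rowPoly_edgeTensor [Field R] [CharZero R] (hE : ∀ e ∈ E, e.card = k) (α : R)
    (δ : ι → ℕ) (f : MvPolynomial (ι × ι) R) :
    apolar (∏ i, rowPoly (edgeTensor k E α) i ^ δ i) f =
      ∑ a ∈ choices E δ, choiceCoeff E α a * apolar (monomial (choiceArcs k E a) 1) f := by
  simp_rw [rowPoly_edgeTensor hE, prod_pow_sum_monomial, map_sum, LinearMap.sum_apply,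
    apolar_monomial, one_mul]

section Mem

variable {δ : ι → ℕ} {a : ι → Option (Finset ι) → ℕ}

theorem mem_of_mem_choices (ha : a ∈ choices E δ) {i : ι} {e : Finset ι}
    (h : a i (some e) ≠ 0) : e ∈ E ∧ i ∈ e := by
  have hi := (Finset.mem_piAntidiag.1 (Fintype.mem_piFinset.1 ha i)).2 _ h
  simpa [rowTerms] using hi

theorem add_sum_of_mem_choices (ha : a ∈ choices E δ) (i : ι) :
    a i none + ∑ e ∈ E, a i (some e) = δ i := by
  rw [← (Finset.mem_piAntidiag.1 (Fintype.mem_piFinset.1 ha i)).1, rowTerms,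
    Finset.sum_insertNone, Finset.sum_filter_of_ne fun e _ h => (mem_of_mem_choices ha h).2]

theorem choiceArcs_apply (ha : a ∈ choices E δ) (x y : ι) :
    choiceArcs k E a (x, y) = a x none * (if x = y then k - 1 else 0) +
      ∑ e ∈ E, a x (some e) * (if y ∈ e.erase x then 1 else 0) := by
  simp only [choiceArcs, Finsupp.finsetSum_apply, rowTerms, Finset.sum_insertNone,
    Finsupp.add_apply, Finsupp.smul_apply, smul_eq_mul, termArcs_none_apply, termArcs_some_apply]
  rw [Finset.sum_eq_single x (fun i _ hi => by simp [hi]) (by simp)]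
  simp only [true_and]
  rw [Finset.sum_filter_of_ne fun e _ h => (mem_of_mem_choices ha (left_ne_zero_of_mul h)).2]

theorem sum_choiceArcs_source (ha : a ∈ choices E δ) (hE : ∀ e ∈ E, e.card = k) (x : ι) :
    ∑ y, choiceArcs k E a (x, y) =
      a x none * (k - 1) + ∑ e ∈ E with x ∈ e, a x (some e) * (k - 1) := by
  simp only [choiceArcs_apply ha, Finset.sum_add_distrib]
  rw [Finset.sum_comm]
  congr 1
  · simp
  · rw [← Finset.sum_filter_of_ne (p := (x ∈ ·)) fun e _ h => ?_]
    · refine Finset.sum_congr rfl fun e he => ?_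
      obtain ⟨he, hx⟩ := Finset.mem_filter.1 he
      rw [← Finset.mul_sum, Finset.sum_boole, Finset.filter_mem_eq_inter, Finset.univ_inter,
        Finset.card_erase_of_mem hx, hE e he, Nat.cast_id]
    · obtain ⟨y, -, hy⟩ := Finset.exists_ne_zero_of_sum_ne_zero h
      exact (mem_of_mem_choices ha (left_ne_zero_of_mul hy)).2

theorem sum_choiceArcs_target (ha : a ∈ choices E δ) (y : ι) :
    ∑ x, choiceArcs k E a (x, y) =
      a y none * (k - 1) + ∑ e ∈ E with y ∈ e, ∑ x ∈ e.erase y, a x (some e) := by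
  simp only [choiceArcs_apply ha, Finset.sum_add_distrib]
  rw [Finset.sum_comm (t := E), Finset.sum_filter]
  congr 1
  · simp
  · refine Finset.sum_congr rfl fun e _ => ?_
    split_ifs with hy
    · simp only [Finset.mem_erase, hy, and_true, mul_ite, mul_one, mul_zero]
      rw [← Finset.sum_filter]
      refine (Finset.sum_subset (by grind) fun x hx hxe => ?_).symm
      by_contra h
      exact hxe (Finset.mem_erase.2 ⟨(Finset.mem_filter.1 hx).2.symm, (mem_of_mem_choices ha h).2⟩)
    · simp [hy]

end Mem

end Choices

section Classification

variable {ι : Type*} [Fintype ι] [DecidableEq ι] {R : Type*} [CommSemiring R] {k N : ℕ}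
  {E : Finset (Finset ι)} {δ : ι → ℕ} {a : ι → Option (Finset ι) → ℕ}

theorem mul_eq_sum_of_coeff_ne_zero (hk : k ≠ 0) (hcut : HasCuts E) (hE : ∀ e ∈ E, e.card = k)
    (ha : a ∈ choices E δ) (hne : coeff (choiceArcs k E a) (powTrace ι R N) ≠ 0)
    {e : Finset ι} (he : e ∈ E) {v : ι} (hv : v ∈ e) :
    k * a v (some e) = ∑ x ∈ e, a x (some e) := by
  obtain ⟨u, hwalk⟩ := exists_isWalk_of_coeff_powTrace_ne_zero hne
  refine hcut.mul_eq_sum hE (b := fun v e => a v (some e)) (fun w => ?_) he hv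
  have hbalance := hwalk.sum_source_eq_sum_target w
  rw [sum_choiceArcs_source ha hE, sum_choiceArcs_target ha, add_right_inj] at hbalance
  have hsplit : ∀ e ∈ E.filter (w ∈ ·),
      ∑ x ∈ e, a x (some e) = a w (some e) + ∑ x ∈ e.erase w, a x (some e) :=
    fun e he => (Finset.add_sum_erase _ _ (Finset.mem_filter.1 he).2).symm
  rw [Finset.sum_congr rfl hsplit, Finset.sum_add_distrib, ← hbalance, ← Finset.sum_add_distrib]
  refine Finset.sum_congr rfl fun e _ => ?_
  obtain ⟨n, rfl⟩ := Nat.exists_eq_succ_of_ne_zero hk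
  rw [Nat.succ_sub_one, Nat.succ_mul, mul_comm, add_comm]

theorem sum_edges_le_of_mem_choices (ha : a ∈ choices E δ) :
    ∑ e ∈ E, ∑ x ∈ e, a x (some e) ≤ ∑ i, δ i :=
  calc ∑ e ∈ E, ∑ x ∈ e, a x (some e) ≤ ∑ e ∈ E, ∑ x, a x (some e) :=
        Finset.sum_le_sum fun e _ => Finset.sum_le_sum_of_subset (Finset.subset_univ _)
    _ = ∑ x, ∑ e ∈ E, a x (some e) := Finset.sum_comm
    _ ≤ ∑ i, δ i := Finset.sum_le_sum fun i _ => by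
        rw [← add_sum_of_mem_choices ha]
        exact Nat.le_add_left _ _

-- Each edge that is used at all is used equally often, hence at least once, by all its vertices;
-- fewer than `2 * k` factors suffice for one such edge only.
theorem choice_some_eq_ite (hcut : HasCuts E) (hE : ∀ e ∈ E, e.card = k)
    (hδ : ∑ i, δ i < 2 * k) (ha : a ∈ choices E δ)
    (hne : coeff (choiceArcs k E a) (powTrace ι R N) ≠ 0) {e : Finset ι} {v : ι}
    (hve : a v (some e) ≠ 0) (f : Finset ι) (x : ι) :
    a x (some f) = if f = e ∧ x ∈ e then 1 else 0 := by
  have hk : k ≠ 0 := by omega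
  have hsum {f : Finset ι} {x : ι} (h : a x (some f) ≠ 0) :
      k * a x (some f) = ∑ y ∈ f, a y (some f) :=
    mul_eq_sum_of_coeff_ne_zero hk hcut hE ha hne (mem_of_mem_choices ha h).1
      (mem_of_mem_choices ha h).2
  have hle := (sum_edges_le_of_mem_choices ha).trans_lt hδ
  obtain ⟨heE, hve'⟩ := mem_of_mem_choices ha hve
  have hone : a v (some e) = 1 := by
    have h := (Finset.single_le_sum (f := fun f => ∑ y ∈ f, a y (some f))
      (fun _ _ => Nat.zero_le _) heE).trans_lt hle
    rw [← hsum hve, mul_comm 2, Nat.mul_lt_mul_left (Nat.pos_of_ne_zero hk)] at h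
    omega
  by_cases hfe : f = e
  · subst hfe
    by_cases hx : x ∈ f
    · have h := (mul_eq_sum_of_coeff_ne_zero hk hcut hE ha hne heE hx).trans (hsum hve).symm
      simpa [hx, hone] using Nat.eq_of_mul_eq_mul_left (Nat.pos_of_ne_zero hk) h
    · rw [if_neg (by tauto)]
      by_contra h
      exact hx (mem_of_mem_choices ha h).2
  · rw [if_neg (by tauto)]
    by_contra h
    have hpair := (Finset.sum_le_sum_of_subset (f := fun f => ∑ y ∈ f, a y (some f))
      (show {f, e} ⊆ E by simp [Finset.insert_subset_iff, heE, (mem_of_mem_choices ha h).1]))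
    rw [Finset.sum_pair hfe, ← hsum h, ← hsum hve, hone] at hpair
    have := Nat.le_mul_of_pos_right k (Nat.pos_of_ne_zero h)
    omega

theorem choice_none_eq_zero (hk : 2 ≤ k) (hE : ∀ e ∈ E, e.card = k) (ha : a ∈ choices E δ)
    (hne : coeff (choiceArcs k E a) (powTrace ι R N) ≠ 0) {e : Finset ι} (he : e ∈ E)
    (hsome : ∀ f x, a x (some f) = if f = e ∧ x ∈ e then 1 else 0) {x : ι} (hx : x ∉ e) :
    a x none = 0 := by
  have harcs (x y : ι) : choiceArcs k E a (x, y) = a x none * (if x = y then k - 1 else 0) +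
      if x ∈ e ∧ y ∈ e ∧ y ≠ x then 1 else 0 := by
    rw [choiceArcs_apply ha, Finset.sum_eq_single e (fun f _ hf => by simp [hsome, hf])
      (fun h => absurd he h), hsome]
    grind
  obtain ⟨u, hwalk⟩ := exists_isWalk_of_coeff_powTrace_ne_zero hne
  have hclosed := hwalk.forall_mem_or_forall_notMem (C := (e : Set ι)) fun x y h => by
    rw [harcs] at h
    simp only [Finset.mem_coe]
    grind
  obtain ⟨v, hv, w, hw, hvw⟩ := Finset.one_lt_card.1 (hE e he ▸ hk : 1 < e.card)
  have hin := hclosed.resolve_right fun h =>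
    h v w (by rw [harcs]; simp [hv, hw, hvw.symm]) hv
  by_contra h
  exact hx (hin x x (by rw [harcs]; simp [h]; omega))

/-- The choice of the diagonal term in all factors. -/
def loopChoice (δ : ι → ℕ) (i : ι) : Option (Finset ι) → ℕ :=
  Pi.single none (δ i)

/-- The choice of the edge `e` once by each of its vertices, and of the diagonal term in the
remaining factors. -/
def edgeChoice (e : Finset ι) (δ : ι → ℕ) (i : ι) : Option (Finset ι) → ℕ :=
  if i ∈ e then Pi.single none (δ i - 1) + Pi.single (some e) 1 else 0

theorem eq_edgeChoice_of_coeff_ne_zero (hk : 2 ≤ k) (hcut : HasCuts E)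
    (hE : ∀ e ∈ E, e.card = k) (hδ : ∑ i, δ i < 2 * k) (ha : a ∈ choices E δ)
    (hne : coeff (choiceArcs k E a) (powTrace ι R N) ≠ 0) {e : Finset ι} {v : ι}
    (hve : a v (some e) ≠ 0) : a = edgeChoice e δ ∧ Finset.univ.filter (δ · ≠ 0) = e := by
  have hsome := choice_some_eq_ite hcut hE hδ ha hne hve
  have he := (mem_of_mem_choices ha hve).1
  have hnone (x : ι) : x ∉ e → a x none = 0 := choice_none_eq_zero hk hE ha hne he hsome
  have hδ' (i : ι) : a i none + (if i ∈ e then 1 else 0) = δ i := by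
    rw [← add_sum_of_mem_choices ha, Finset.sum_eq_single e (fun f _ hf => by simp [hsome, hf])
      (fun h => absurd he h), hsome]
    simp
  constructor
  · funext i o
    have := hδ' i
    rcases o with _ | f <;> by_cases hi : i ∈ e
    · simp [edgeChoice, hi] at this ⊢; omega
    · simp [edgeChoice, hi, hnone]
    · simp [edgeChoice, hi, hsome, Pi.single_apply]
    · simp [edgeChoice, hi, hsome]
  · ext i
    have := hδ' i
    by_cases hi : i ∈ e
    · simp [hi] at this ⊢; omega
    · simpa [hi, hnone] using this.symm

theorem eq_loopChoice_of_coeff_ne_zero (hk : 2 ≤ k) (hδ : δ ≠ 0) (ha : a ∈ choices E δ)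
    (hne : coeff (choiceArcs k E a) (powTrace ι R N) ≠ 0) (hsome : ∀ x e, a x (some e) = 0) :
    a = loopChoice δ ∧ ∃ i, δ = Pi.single i (∑ j, δ j) := by
  have hnone (i : ι) : a i none = δ i := by
    rw [← add_sum_of_mem_choices ha]
    simp [hsome]
  have harcs (x y : ι) : choiceArcs k E a (x, y) = δ x * if x = y then k - 1 else 0 := by
    rw [choiceArcs_apply ha]
    simp [hsome, hnone]
  refine ⟨?_, ?_⟩
  · funext i o
    rcases o with _ | e <;> simp [loopChoice, hnone, hsome]
  · obtain ⟨u, hwalk⟩ := exists_isWalk_of_coeff_powTrace_ne_zero hne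
    obtain ⟨i, hi⟩ := Function.ne_iff.1 hδ
    have hin := (hwalk.forall_mem_or_forall_notMem (C := {i}) fun x y h => by
      rw [harcs] at h
      grind).resolve_right fun h => h i i (by rw [harcs]; simp at hi; simp [hi]; omega) rfl
    have hzero (j : ι) (hj : j ≠ i) : δ j = 0 := by
      by_contra h
      exact hj (hin j j (by rw [harcs]; simp [h]; omega))
    refine ⟨i, funext fun j => ?_⟩
    rw [Finset.sum_eq_single i (fun j _ => hzero j) (by simp), Pi.single_apply]
    split_ifs with h
    exacts [h ▸ rfl, hzero j h]

theorem eq_loopChoice_or_eq_edgeChoice (hk : 2 ≤ k) (hcut : HasCuts E)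
    (hE : ∀ e ∈ E, e.card = k) (hδ0 : δ ≠ 0) (hδ : ∑ i, δ i < 2 * k) (ha : a ∈ choices E δ)
    (hne : apolar (monomial (choiceArcs k E a) 1) (powTrace ι R N) ≠ 0) :
    (a = loopChoice δ ∧ ∃ i, δ = Pi.single i (∑ j, δ j)) ∨
      ∃ e ∈ E, a = edgeChoice e δ ∧ Finset.univ.filter (δ · ≠ 0) = e := by
  rw [apolar_monomial, one_mul] at hne
  replace hne := right_ne_zero_of_mul hne
  by_cases hsome : ∀ x e, a x (some e) = 0
  · exact .inl (eq_loopChoice_of_coeff_ne_zero hk hδ0 ha hne hsome)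
  · push Not at hsome
    obtain ⟨x, e, hxe⟩ := hsome
    exact .inr ⟨e, (mem_of_mem_choices ha hxe).1,
      eq_edgeChoice_of_coeff_ne_zero hk hcut hE hδ ha hne hxe⟩

end Classification

theorem multinomial_single_add_single {O : Type*} [DecidableEq O] {s : Finset O} {o o' : O}
    (ho : o ∈ s) (ho' : o' ∈ s) (h : o ≠ o') (n : ℕ) :
    Nat.multinomial s (Pi.single o n + Pi.single o' 1) = n + 1 := by
  have hsupp : ∀ x ∈ s, x ∉ ({o, o'} : Finset O) →
      (Pi.single o n + Pi.single o' 1 : O → ℕ) x = 0 := fun x _ hx => by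
    rw [Finset.mem_insert, Finset.mem_singleton, not_or] at hx
    simp [hx.1, hx.2]
  have hpair : ({o, o'} : Finset O) ⊆ s := by simp [Finset.insert_subset_iff, ho, ho']
  have hs := Nat.multinomial_spec s (Pi.single o n + Pi.single o' 1)
  rw [← Finset.sum_subset hpair hsupp, ← Finset.prod_subset hpair fun x hx hx' => by
    rw [hsupp x hx hx', Nat.factorial_zero], Finset.sum_pair h, Finset.prod_pair h] at hs
  simp only [Pi.add_apply, Pi.single_eq_same, Pi.single_eq_of_ne h, Pi.single_eq_of_ne h.symm,
    add_zero, zero_add, Nat.factorial_zero, mul_one, Nat.factorial_succ, mul_comm (n + 1)] at hs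
  exact Nat.eq_of_mul_eq_mul_left n.factorial_pos hs

section CompleteArcs

variable {ι : Type*} [DecidableEq ι]

theorem completeArcs_apply (S : Finset ι) (c : ι → ℕ) (x y : ι) :
    completeArcs S c (x, y) = if x ∈ S ∧ y ∈ S then if x = y then c x else 1 else 0 := by
  simp only [completeArcs, Finsupp.finsetSum_apply, Finsupp.single_apply, Prod.mk.injEq]
  by_cases hx : x ∈ S
  · rw [Finset.sum_eq_single x (fun u _ hu => by simp [hu]) (fun h => absurd hx h)]
    by_cases hy : y ∈ S <;> simp [hx, hy]
  · rw [if_neg (by tauto)]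
    exact Finset.sum_eq_zero fun u hu => Finset.sum_eq_zero fun v _ =>
      if_neg (by rintro ⟨rfl, -⟩; exact hx hu)

theorem degree_completeArcs (S : Finset ι) (c : ι → ℕ) :
    (completeArcs S c).degree = ∑ u ∈ S, (c u + (S.card - 1)) := by
  rw [completeArcs, map_sum]
  refine Finset.sum_congr rfl fun u hu => ?_
  rw [map_sum, ← Finset.add_sum_erase _ _ hu, Finset.sum_congr rfl fun v hv => by
    rw [Finsupp.degree_single, if_neg (Finset.ne_of_mem_erase hv).symm], Finset.sum_const,
    Finset.card_erase_of_mem hu]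
  simp

end CompleteArcs

section Contribution

variable {ι : Type*} [Fintype ι] [DecidableEq ι] {R : Type*} {k : ℕ}
  {E : Finset (Finset ι)} {δ : ι → ℕ} {e : Finset ι}

theorem loopChoice_mem_choices (E : Finset (Finset ι)) (δ : ι → ℕ) :
    loopChoice δ ∈ choices E δ := by
  refine Fintype.mem_piFinset.2 fun i => Finset.mem_piAntidiag.2 ⟨?_, fun o ho => ?_⟩
  · simp [loopChoice, rowTerms]
  · obtain rfl : o = none := by
      by_contra h
      simp [loopChoice, h] at ho
    simp [rowTerms]

theorem choiceArcs_loopChoice (k : ℕ) (E : Finset (Finset ι)) (i : ι) (d : ℕ) :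
    choiceArcs k E (loopChoice (Pi.single i d)) = Finsupp.single (i, i) (d * (k - 1)) := by
  ext ⟨x, y⟩
  rw [choiceArcs_apply (loopChoice_mem_choices E _)]
  rw [Finset.sum_eq_zero (fun e _ => by simp [loopChoice]), loopChoice, Pi.single_eq_same,
    Finsupp.single_apply, Pi.single_apply]
  simp only [Prod.mk.injEq]
  grind

theorem choiceCoeff_loopChoice [CommRing R] (α : R) (δ : ι → ℕ) :
    choiceCoeff E α (loopChoice δ) = ∏ i, (α * edgeDegree E i) ^ δ i := by
  refine Finset.prod_congr rfl fun i _ => ?_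
  rw [loopChoice, Nat.multinomial_single, Nat.cast_one, one_mul,
    Finset.prod_eq_single none (fun o _ ho => by simp [ho]) (by simp [rowTerms])]
  simp [termCoeff]

theorem edgeChoice_mem_choices (he : e ∈ E) (hδ : Finset.univ.filter (δ · ≠ 0) = e) :
    edgeChoice e δ ∈ choices E δ := by
  have hmem (i : ι) : δ i ≠ 0 ↔ i ∈ e := by simp [← hδ]
  refine Fintype.mem_piFinset.2 fun i => Finset.mem_piAntidiag.2 ⟨?_, fun o ho => ?_⟩
  · by_cases hi : i ∈ e
    · have hpos := Nat.pos_of_ne_zero ((hmem i).2 hi)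
      simp only [edgeChoice, rowTerms, Finset.sum_insertNone, if_pos hi, Pi.add_apply]
      simp [Pi.single_apply, he, hi]
      omega
    · simpa [edgeChoice, hi, eq_comm] using (hmem i).not.2 hi
  · rcases o with _ | f
    · simp [rowTerms]
    · by_cases hi : i ∈ e
      · obtain rfl : f = e := by
          by_contra hf
          simp [edgeChoice, hi, hf] at ho
        simp [rowTerms, he, hi]
      · simp [edgeChoice, hi] at ho

theorem choiceArcs_edgeChoice (he : e ∈ E) (hδ : Finset.univ.filter (δ · ≠ 0) = e) :
    choiceArcs k E (edgeChoice e δ) = completeArcs e fun u => (δ u - 1) * (k - 1) := by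
  ext ⟨x, y⟩
  rw [choiceArcs_apply (edgeChoice_mem_choices he hδ), completeArcs_apply,
    Finset.sum_eq_single e (fun f _ hf => by by_cases hx : x ∈ e <;> simp [edgeChoice, hx, hf])
      (fun h => absurd he h)]
  by_cases hx : x ∈ e
  · by_cases hxy : x = y
    · subst hxy
      simp [edgeChoice, hx]
    · simp [edgeChoice, hx, hxy, Ne.symm hxy]
  · simp [edgeChoice, hx]

theorem choiceCoeff_edgeChoice [CommRing R] (α : R) (he : e ∈ E) (hek : e.card = k)
    (hδ : Finset.univ.filter (δ · ≠ 0) = e) :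
    choiceCoeff E α (edgeChoice e δ) =
      (1 - α) ^ k * ((∏ i ∈ e, (δ i : R)) * ∏ i ∈ e, (α * edgeDegree E i) ^ (δ i - 1)) := by
  rw [choiceCoeff, ← Finset.prod_subset (Finset.subset_univ e) fun i _ hi => by
      simp [edgeChoice, hi, Nat.multinomial], ← hek,
    ← Finset.prod_const (1 - α), ← Finset.prod_mul_distrib, ← Finset.prod_mul_distrib]
  refine Finset.prod_congr rfl fun i hi => ?_
  have hδi : δ i ≠ 0 := by simpa [← hδ] using hi
  have hsome : some e ∈ rowTerms E i := by simp [rowTerms, he, hi]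
  have hnone : none ∈ rowTerms E i := by simp [rowTerms]
  simp only [edgeChoice, if_pos hi]
  rw [multinomial_single_add_single hnone hsome (by simp),
    Nat.sub_add_cancel (Nat.pos_of_ne_zero hδi)]
  simp only [Pi.add_apply, pow_add, Finset.prod_mul_distrib]
  rw [Finset.prod_eq_single none (fun o _ ho => by simp [ho]) (absurd hnone),
    Finset.prod_eq_single (some e) (fun o _ ho => by simp [ho]) (absurd hsome)]
  simp only [Pi.single_eq_same, termCoeff, pow_one]
  ring

theorem filter_single_ne_zero (i : ι) {d : ℕ} (hd : d ≠ 0) :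
    Finset.univ.filter ((Pi.single i d : ι → ℕ) · ≠ 0) = {i} := by
  ext j
  simp [Pi.single_apply, hd]

/-- The summand of `trace_eq_apolar` for `edgeTensor k E α` and the row multiplicities `δ`. -/
noncomputable def contribution [Field R] (k : ℕ) (E : Finset (Finset ι)) (α : R) (δ : ι → ℕ) : R :=
  (∏ i, ((Nat.factorial (δ i * (k - 1)) : R)⁻¹)) *
    apolar (∏ i, rowPoly (edgeTensor k E α) i ^ δ i) (powTrace ι R ((∑ i, δ i) * (k - 1)))

/-- The weight with which a single edge on the support of `δ`, together with `δ v - 1` diagonal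
factors at each of its vertices `v`, contributes to a trace. -/
noncomputable def edgeWeight (R : Type*) [Field R] (k : ℕ) (δ : ι → ℕ) : R :=
  (∏ i, ((Nat.factorial (δ i * (k - 1)) : R)⁻¹)) * (∏ i with δ i ≠ 0, (δ i : R)) *
    apolar (monomial (completeArcs (Finset.univ.filter (δ · ≠ 0)) fun u => (δ u - 1) * (k - 1)) 1)
      (powTrace ι R ((∑ i, δ i) * (k - 1)))

/-- The contribution of the edge `e` to the trace of order `d`, where `w` lists the diagonal
entries. -/
noncomputable def edgeSum [Field R] (k d : ℕ) (e : Finset ι) (w : ι → R) : R :=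
  ∑ δ ∈ Finset.piAntidiag Finset.univ d with Finset.univ.filter (δ · ≠ 0) = e,
    edgeWeight R k δ * ∏ i ∈ e, w i ^ (δ i - 1)

section CharZero

variable [Field R] [CharZero R]

theorem contribution_single (hk : 2 ≤ k) (hcut : HasCuts E) (hE : ∀ e ∈ E, e.card = k) (α : R)
    (i : ι) {d : ℕ} (hd0 : d ≠ 0) (hd : d < 2 * k) :
    contribution k E α (Pi.single i d) = (α * edgeDegree E i) ^ d := by
  have hsum : ∑ j, (Pi.single i d : ι → ℕ) j = d := by simp
  have hfactorial : ((d * (k - 1)).factorial : R) ≠ 0 := by exact_mod_cast Nat.factorial_ne_zero _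
  rw [contribution, hsum, apolar_prod_rowPoly_edgeTensor hE,
    Finset.sum_eq_single (loopChoice (Pi.single i d)) (fun a ha h => ?_)
      (absurd (loopChoice_mem_choices E _)), choiceCoeff_loopChoice, choiceArcs_loopChoice,
    apolar_monomial, coeff_powTrace_loops i (Nat.mul_ne_zero hd0 (by omega)),
    Finset.prod_eq_single i (fun j _ hj => by simp [hj]) (by simp),
    Finset.prod_eq_single i (fun j _ hj => by simp [hj]) (by simp), Pi.single_eq_same,
    Finsupp.prod_single_index (by simp), mul_one, one_mul, mul_left_comm,
    inv_mul_cancel₀ hfactorial, mul_one]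
  by_contra hne
  obtain ⟨ha, -⟩ | ⟨e, he, -, hsupp⟩ := eq_loopChoice_or_eq_edgeChoice hk hcut hE
    (by simpa using hd0) (by rwa [hsum]) ha (right_ne_zero_of_mul hne)
  · exact h ha
  · have := hE e he
    rw [← hsupp, filter_single_ne_zero i hd0, Finset.card_singleton] at this
    omega

theorem contribution_eq_edgeWeight_mul (hk : 2 ≤ k) (hcut : HasCuts E)
    (hE : ∀ e ∈ E, e.card = k) (α : R) (hδ0 : δ ≠ 0) (hδ : ∑ i, δ i < 2 * k) {e : Finset ι}
    (he : e ∈ E) (hsupp : Finset.univ.filter (δ · ≠ 0) = e) :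
    contribution k E α δ =
      (1 - α) ^ k * (edgeWeight R k δ * ∏ i ∈ e, (α * edgeDegree E i) ^ (δ i - 1)) := by
  have hcard := hE e he
  rw [contribution, apolar_prod_rowPoly_edgeTensor hE,
    Finset.sum_eq_single (edgeChoice e δ) (fun a ha h => ?_)
      (absurd (edgeChoice_mem_choices he hsupp)), choiceCoeff_edgeChoice α he hcard hsupp,
    choiceArcs_edgeChoice he hsupp, edgeWeight, hsupp]
  · ring
  by_contra hne
  obtain ⟨-, i, hi⟩ | ⟨f, -, ha, hsupp'⟩ := eq_loopChoice_or_eq_edgeChoice hk hcut hE hδ0 hδ ha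
    (right_ne_zero_of_mul hne)
  · rw [← hsupp, hi, filter_single_ne_zero i fun h => hδ0 (by rw [hi, h, Pi.single_zero]),
      Finset.card_singleton] at hcard
    omega
  · exact h (by rw [ha, ← hsupp, hsupp'])

theorem contribution_eq_zero (hk : 2 ≤ k) (hcut : HasCuts E) (hE : ∀ e ∈ E, e.card = k) (α : R)
    (hδ0 : δ ≠ 0) (hδ : ∑ i, δ i < 2 * k) (hsingle : ∀ i, δ ≠ Pi.single i (∑ j, δ j))
    (hsupp : Finset.univ.filter (δ · ≠ 0) ∉ E) : contribution k E α δ = 0 := by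
  rw [contribution, apolar_prod_rowPoly_edgeTensor hE, Finset.sum_eq_zero fun a ha => ?_, mul_zero]
  by_contra hne
  obtain ⟨-, i, hi⟩ | ⟨e, he, -, hsupp'⟩ := eq_loopChoice_or_eq_edgeChoice hk hcut hE hδ0 hδ ha
    (right_ne_zero_of_mul hne)
  · exact hsingle i hi
  · exact hsupp (hsupp' ▸ he)

theorem contribution_eq_sum_ite (hk : 2 ≤ k) (hcut : HasCuts E) (hE : ∀ e ∈ E, e.card = k) (α : R)
    {d : ℕ} (hd0 : d ≠ 0) (hd : d < 2 * k) (hδ : ∑ i, δ i = d) :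
    contribution k E α δ =
      (∑ i, if δ = Pi.single i d then (α * edgeDegree E i) ^ d else 0) +
        ∑ e ∈ E, if Finset.univ.filter (δ · ≠ 0) = e then
          (1 - α) ^ k * (edgeWeight R k δ * ∏ i ∈ e, (α * edgeDegree E i) ^ (δ i - 1)) else 0 := by
  have hδ0 : δ ≠ 0 := by
    rintro rfl
    exact hd0 (by simpa using hδ.symm)
  rw [Finset.sum_ite_eq]
  by_cases hsingle : ∃ i, δ = Pi.single i d
  · obtain ⟨i, rfl⟩ := hsingle
    have hsupp : Finset.univ.filter ((Pi.single i d : ι → ℕ) · ≠ 0) ∉ E := fun h => by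
      have := hE _ h
      rw [filter_single_ne_zero i hd0, Finset.card_singleton] at this
      omega
    rw [if_neg hsupp, add_zero, contribution_single hk hcut hE α i hd0 hd,
      Finset.sum_eq_single i (fun j _ hj => if_neg fun h => hj ?_) (by simp), if_pos rfl]
    exact Finset.singleton_injective
      (by rw [← filter_single_ne_zero i hd0, h, filter_single_ne_zero j hd0])
  · rw [Finset.sum_eq_zero fun i _ => if_neg fun h => hsingle ⟨i, h⟩, zero_add]
    split_ifs with hsupp
    · exact contribution_eq_edgeWeight_mul hk hcut hE α hδ0 (hδ.trans_lt hd) hsupp rfl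
    · exact contribution_eq_zero hk hcut hE α hδ0 (hδ.trans_lt hd)
        (fun i h => hsingle ⟨i, hδ ▸ h⟩) hsupp

theorem trace_edgeTensor (hk : 2 ≤ k) (hcut : HasCuts E) (hE : ∀ e ∈ E, e.card = k) (α : R)
    {d : ℕ} (hd0 : d ≠ 0) (hd : d < 2 * k) :
    trace d (edgeTensor k E α) = ((k : R) - 1) ^ (Fintype.card ι - 1) *
      ((∑ i, (α * edgeDegree E i) ^ d) +
        (1 - α) ^ k * ∑ e ∈ E, edgeSum k d e fun i => α * edgeDegree E i) := by
  have hsum : ∀ δ ∈ Finset.piAntidiag (Finset.univ : Finset ι) d, ∑ i, δ i = d :=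
    fun δ hδ => (Finset.mem_piAntidiag.1 hδ).1
  have hcontribution : trace d (edgeTensor k E α) = ((k : R) - 1) ^ (Fintype.card ι - 1) *
      ∑ δ ∈ Finset.piAntidiag (Finset.univ : Finset ι) d, contribution k E α δ := by
    rw [trace_eq_apolar]
    congr 1
    exact Finset.sum_congr rfl fun δ hδ => by rw [contribution, hsum δ hδ]
  rw [hcontribution, Finset.sum_congr rfl fun δ hδ =>
    contribution_eq_sum_ite hk hcut hE α hd0 hd (hsum δ hδ), Finset.sum_add_distrib]
  congr 2
  · rw [Finset.sum_comm]
    refine Finset.sum_congr rfl fun i _ => ?_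
    rw [Finset.sum_ite_eq', if_pos (by simp [Finset.mem_piAntidiag])]
  · rw [Finset.sum_comm, Finset.mul_sum]
    simp only [edgeSum, Finset.sum_filter, Finset.mul_sum, mul_ite, mul_zero]

end CharZero

end Contribution

section EdgeSum

theorem exists_perm_comp_eq {ι β : Type*} [Fintype ι] [DecidableEq β] {f g : ι → β}
    (h : ∀ b, (Finset.univ.filter (f · = b)).card = (Finset.univ.filter (g · = b)).card) :
    ∃ σ : Equiv.Perm ι, g ∘ σ = f :=
  ⟨Equiv.ofFiberEquiv fun b => Fintype.equivOfCardEq (by simpa [Fintype.card_subtype] using h b),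
    funext (Equiv.ofFiberEquiv_map _)⟩

theorem eq_single_of_mem_piAntidiag {ι : Type*} [DecidableEq ι] {e : Finset ι} {n : ℕ}
    {γ : ι → ℕ} (hγ : γ ∈ Finset.piAntidiag e n) {i : ι} (hi : i ∈ e) (hn : n ≤ γ i) :
    γ = Pi.single i n := by
  obtain ⟨hsum, hsupp⟩ := Finset.mem_piAntidiag.1 hγ
  rw [← Finset.add_sum_erase e γ hi] at hsum
  have hzero := (Finset.sum_eq_zero_iff (s := e.erase i) (f := γ)).1 (by omega)
  funext j
  by_cases hj : j = i
  · subst hj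
    rw [Pi.single_eq_same]
    omega
  · rw [Pi.single_eq_of_ne hj]
    by_contra hne
    exact hne (hzero j (Finset.mem_erase.2 ⟨hj, hsupp j hne⟩))

variable {ι : Type*} [Fintype ι] [DecidableEq ι] {R : Type*} {k : ℕ} {e e' : Finset ι}

theorem edgeWeight_comp_perm [Field R] (σ : Equiv.Perm ι) (δ : ι → ℕ) :
    edgeWeight R k (δ ∘ σ) = edgeWeight R k δ := by
  have hsupp : Finset.univ.filter (δ · ≠ 0) =
      (Finset.univ.filter ((δ ∘ σ) · ≠ 0)).map σ.toEmbedding := by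
    ext x
    simp
  have harcs : completeArcs (Finset.univ.filter (δ · ≠ 0)) (fun u => (δ u - 1) * (k - 1)) =
      Finsupp.mapDomain (Prod.map σ σ) (completeArcs (Finset.univ.filter ((δ ∘ σ) · ≠ 0))
        fun u => ((δ ∘ σ) u - 1) * (k - 1)) := by
    simp only [completeArcs, Finsupp.mapDomain_finsetSum, hsupp, Finset.sum_map,
      Finsupp.mapDomain_single]
    simp
  rw [edgeWeight, edgeWeight, harcs, ← rename_monomial, ← rename_powTrace σ ((∑ i, δ i) * (k - 1)),
    apolar_rename (σ.injective.prodMap σ.injective), ← Equiv.sum_comp σ δ, hsupp, Finset.prod_map,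
    ← Equiv.prod_comp σ fun i => ((δ i * (k - 1)).factorial : R)⁻¹]
  rfl

theorem edgeWeight_pos [Field R] [LinearOrder R] [IsStrictOrderedRing R] (hk : k ≠ 0) {δ : ι → ℕ}
    (hδ : (Finset.univ.filter (δ · ≠ 0)).card = k) : 0 < edgeWeight R k δ := by
  obtain ⟨r, hr⟩ : (Finset.univ.filter (δ · ≠ 0)).Nonempty := by
    rw [← Finset.card_pos]
    omega
  have hcoeff := (isWalk_completeArcs hr fun u => (δ u - 1) * (k - 1)).coeff_powTrace_pos (R := R)
  have hdegree : (completeArcs (Finset.univ.filter (δ · ≠ 0))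
      fun u => (δ u - 1) * (k - 1)).degree = (∑ i, δ i) * (k - 1) := by
    rw [degree_completeArcs, hδ, ← Finset.sum_filter_ne_zero (f := δ), Finset.sum_mul]
    refine Finset.sum_congr rfl fun u hu => ?_
    obtain ⟨n, hn⟩ := Nat.exists_eq_succ_of_ne_zero (Finset.mem_filter.1 hu).2
    rw [hn, Nat.succ_sub_one, Nat.succ_mul]
  rw [hdegree] at hcoeff
  rw [edgeWeight, apolar_monomial, one_mul]
  refine mul_pos (mul_pos (Finset.prod_pos fun i _ => ?_) (Finset.prod_pos fun i hi => ?_))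
    (mul_pos (Finset.prod_pos fun _ _ => ?_) hcoeff)
  · exact inv_pos.2 (Nat.cast_pos.2 (Nat.factorial_pos _))
  · exact Nat.cast_pos.2 (Nat.pos_of_ne_zero (Finset.mem_filter.1 hi).2)
  · exact Nat.cast_pos.2 (Nat.factorial_pos _)

/-- The weight of the row multiplicities that exceed those of a single use of `e` by `γ`. -/
noncomputable def excessWeight (R : Type*) [Field R] (k : ℕ) (e : Finset ι) (γ : ι → ℕ) : R :=
  edgeWeight R k fun i => if i ∈ e then γ i + 1 else 0

section Field

variable [Field R]

theorem excessWeight_congr {γ γ' : ι → ℕ} (he : e.card = e'.card)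
    (h : ∀ m, (e.filter (γ · = m)).card = (e'.filter (γ' · = m)).card) :
    excessWeight R k e γ = excessWeight R k e' γ' := by
  have hzero (e : Finset ι) (γ : ι → ℕ) :
      (Finset.univ.filter fun i => (if i ∈ e then γ i + 1 else 0) = 0) = eᶜ := by
    ext i
    simp
  have hsucc (e : Finset ι) (γ : ι → ℕ) (m : ℕ) :
      (Finset.univ.filter fun i => (if i ∈ e then γ i + 1 else 0) = m + 1) =
        e.filter (γ · = m) := by
    ext i
    by_cases hi : i ∈ e <;> simp [hi]
  obtain ⟨σ, hσ⟩ := exists_perm_comp_eq (f := fun i => if i ∈ e then γ i + 1 else 0)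
    (g := fun i => if i ∈ e' then γ' i + 1 else 0) fun m => by
      cases m with
      | zero => rw [hzero, hzero, Finset.card_compl, Finset.card_compl, he]
      | succ m => rw [hsucc, hsucc, h]
  rw [excessWeight, ← hσ, edgeWeight_comp_perm, excessWeight]

theorem edgeSum_eq_zero {d : ℕ} (hd : d < e.card) (w : ι → R) : edgeSum k d e w = 0 := by
  refine Finset.sum_eq_zero fun δ hδ => absurd hd (not_lt.2 ?_)
  rw [Finset.mem_filter, Finset.mem_piAntidiag] at hδ
  rw [← hδ.1.1, ← hδ.2, ← Finset.sum_filter_ne_zero, Finset.card_eq_sum_ones]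
  exact Finset.sum_le_sum fun i hi => Nat.one_le_iff_ne_zero.2 (Finset.mem_filter.1 hi).2

theorem edgeSum_card_add (n : ℕ) (e : Finset ι) (w : ι → R) :
    edgeSum k (e.card + n) e w =
      ∑ γ ∈ Finset.piAntidiag e n, excessWeight R k e γ * ∏ i ∈ e, w i ^ γ i := by
  have hraise {δ : ι → ℕ} (hδ : Finset.univ.filter (δ · ≠ 0) = e) :
      (fun i => if i ∈ e then δ i - 1 + 1 else 0) = δ := funext fun i => by
    simp only [← hδ, Finset.mem_filter, Finset.mem_univ, true_and]
    grind
  have hsum (γ : ι → ℕ) : (∑ i, if i ∈ e then γ i + 1 else 0) = e.card + ∑ i ∈ e, γ i := by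
    rw [Finset.sum_ite_mem, Finset.univ_inter, Finset.sum_add_distrib, ← Finset.card_eq_sum_ones,
      add_comm]
  refine Finset.sum_nbij' (fun δ i => δ i - 1) (fun γ i => if i ∈ e then γ i + 1 else 0)
    (fun δ hδ => ?_) (fun γ hγ => ?_) (fun δ hδ => ?_) (fun γ hγ => ?_) fun δ hδ => ?_
  · obtain ⟨hδ, hsupp⟩ := Finset.mem_filter.1 hδ
    have h := hsum fun i => δ i - 1
    rw [hraise hsupp, (Finset.mem_piAntidiag.1 hδ).1, add_right_inj] at h
    refine Finset.mem_piAntidiag.2 ⟨h.symm, fun i hi => ?_⟩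
    simp only [← hsupp, Finset.mem_filter, Finset.mem_univ, true_and]
    omega
  · refine Finset.mem_filter.2 ⟨Finset.mem_piAntidiag.2 ⟨?_, by simp⟩, by ext; simp⟩
    rw [hsum, (Finset.mem_piAntidiag.1 hγ).1]
  · exact hraise (Finset.mem_filter.1 hδ).2
  · funext i
    have := (Finset.mem_piAntidiag.1 hγ).2 i
    grind
  · rw [excessWeight, hraise (Finset.mem_filter.1 hδ).2]

end Field

section OrderedField

variable [Field R] [LinearOrder R] [IsStrictOrderedRing R]

theorem excessWeight_pos (he : e.Nonempty) (γ : ι → ℕ) : 0 < excessWeight R e.card e γ :=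
  edgeWeight_pos he.card_ne_zero (by simp)

theorem exists_pos_excessWeight_eq_of_le_one (ι R : Type*) [Fintype ι] [DecidableEq ι] [Field R]
    [LinearOrder R] [IsStrictOrderedRing R] (hk : k ≠ 0) (n : ℕ) :
    ∃ c : R, 0 < c ∧ ∀ e : Finset ι, e.card = k → ∀ γ ∈ Finset.piAntidiag e n,
      (∀ i ∈ e, γ i ≤ 1) → excessWeight R k e γ = c := by
  have hcount {e : Finset ι} {γ : ι → ℕ} (hγ : γ ∈ Finset.piAntidiag e n)
      (h : ∀ i ∈ e, γ i ≤ 1) (m : ℕ) : (e.filter (γ · = m)).card =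
        if m = 0 then e.card - n else if m = 1 then n else 0 := by
    have hone : (e.filter (γ · = 1)).card = n := by
      rw [← (Finset.mem_piAntidiag.1 hγ).1, Finset.card_filter]
      exact Finset.sum_congr rfl fun i hi => by have := h i hi; split_ifs <;> omega
    split_ifs with h0 h1
    · subst h0
      rw [← Finset.card_filter_add_card_filter_not (s := e) (γ · = 1), hone, add_tsub_cancel_left]
      exact congrArg _ (Finset.filter_congr fun i hi => by have := h i hi; omega)
    · rw [h1, hone]
    · rw [Finset.card_eq_zero, Finset.filter_eq_empty_iff]
      intro i hi
      have := h i hi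
      omega
  by_cases hex : ∃ e : Finset ι, e.card = k ∧ ∃ γ ∈ Finset.piAntidiag e n, ∀ i ∈ e, γ i ≤ 1
  · obtain ⟨e, rfl, γ, hγ, hle⟩ := hex
    refine ⟨excessWeight R e.card e γ, excessWeight_pos (Finset.card_ne_zero.1 hk) γ,
      fun e' he' γ' hγ' hle' => excessWeight_congr he' fun m => ?_⟩
    rw [hcount hγ' hle', hcount hγ hle, he']
  · exact ⟨1, one_pos, fun e he γ hγ hle => absurd ⟨e, he, γ, hγ, hle⟩ hex⟩

theorem multinomial_eq_factorial_of_le_one {O : Type*} {s : Finset O} {γ : O → ℕ}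
    (h : ∀ i ∈ s, γ i ≤ 1) : Nat.multinomial s γ = (∑ i ∈ s, γ i).factorial := by
  rw [Nat.multinomial, Finset.prod_eq_one fun i hi => Nat.factorial_eq_one.2 (h i hi), Nat.div_one]

theorem exists_edgeSum_eq_mul_pow (ι R : Type*) [Fintype ι] [DecidableEq ι] [Field R]
    [LinearOrder R] [IsStrictOrderedRing R] (hk : k ≠ 0) {n : ℕ} (hn : n ≤ 1) :
    ∃ c : R, ∀ e : Finset ι, e.card = k → ∀ w : ι → R,
      edgeSum k (k + n) e w = c * (∑ i ∈ e, w i) ^ n := by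
  obtain ⟨c, -, hc⟩ := exists_pos_excessWeight_eq_of_le_one ι R hk n
  refine ⟨c, fun e he w => ?_⟩
  have hle {γ : ι → ℕ} (hγ : γ ∈ Finset.piAntidiag e n) : ∀ i ∈ e, γ i ≤ 1 := fun i hi =>
    ((Finset.single_le_sum (fun _ _ => Nat.zero_le _) hi).trans_eq
      (Finset.mem_piAntidiag.1 hγ).1).trans hn
  rw [← he, edgeSum_card_add, he, Finset.sum_pow_eq_sum_piAntidiag, Finset.mul_sum]
  refine Finset.sum_congr rfl fun γ hγ => ?_
  rw [hc e he γ hγ (hle hγ), multinomial_eq_factorial_of_le_one (hle hγ),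
    (Finset.mem_piAntidiag.1 hγ).1, Nat.factorial_eq_one.2 hn, Nat.cast_one, one_mul]

theorem exists_excessWeight_single_eq (ι R : Type*) [Fintype ι] [DecidableEq ι] [Field R]
    (k n : ℕ) : ∃ c : R, ∀ e : Finset ι, e.card = k → ∀ i ∈ e,
      excessWeight R k e (Pi.single i n) = c := by
  have hcount {e : Finset ι} {i : ι} (hi : i ∈ e) (m : ℕ) :
      (e.filter (Pi.single (M := fun _ => ℕ) i n · = m)).card =
        (if 0 = m then e.card - 1 else 0) + if n = m then 1 else 0 := by
    rw [Finset.card_filter, ← Finset.sum_erase_add _ _ hi, Pi.single_eq_same,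
      Finset.sum_congr rfl fun j hj => by rw [Pi.single_eq_of_ne (Finset.ne_of_mem_erase hj)],
      Finset.sum_const, Finset.card_erase_of_mem hi, smul_eq_mul, mul_ite, mul_one, mul_zero]
  by_cases hex : ∃ e : Finset ι, e.card = k ∧ e.Nonempty
  · obtain ⟨e, he, i, hi⟩ := hex
    exact ⟨excessWeight R k e (Pi.single i n), fun e' he' i' hi' =>
      excessWeight_congr (he'.trans he.symm) fun m => by rw [hcount hi', hcount hi, he, he']⟩
  · exact ⟨0, fun e he i hi => absurd ⟨e, he, i, hi⟩ hex⟩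

theorem exists_edgeSum_add_two (ι R : Type*) [Fintype ι] [DecidableEq ι] [Field R]
    [LinearOrder R] [IsStrictOrderedRing R] (hk : k ≠ 0) :
    ∃ a b : R, 0 < a ∧ ∀ e : Finset ι, e.card = k → ∀ w : ι → R,
      edgeSum k (k + 2) e w = a * (∑ i ∈ e, w i) ^ 2 + b * ∑ i ∈ e, w i ^ 2 := by
  obtain ⟨c, hc0, hc⟩ := exists_pos_excessWeight_eq_of_le_one ι R hk 2
  obtain ⟨p, hp⟩ := exists_excessWeight_single_eq ι R k 2
  refine ⟨c / 2, p - c / 2, half_pos hc0, fun e he w => ?_⟩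
  have hterm : ∀ γ ∈ Finset.piAntidiag e 2, excessWeight R k e γ * ∏ i ∈ e, w i ^ γ i =
      c / 2 * (Nat.multinomial e γ * ∏ i ∈ e, w i ^ γ i) +
        ∑ i ∈ e, if γ = Pi.single i 2 then (p - c / 2) * w i ^ 2 else 0 := by
    intro γ hγ
    by_cases hsingle : ∃ i ∈ e, γ = Pi.single i 2
    · obtain ⟨i, hi, rfl⟩ := hsingle
      have hprod : ∏ j ∈ e, w j ^ (Pi.single i 2 : ι → ℕ) j = w i ^ 2 := by
        rw [Finset.prod_eq_single_of_mem i hi fun j _ hj => by rw [Pi.single_eq_of_ne hj, pow_zero],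
          Pi.single_eq_same]
      rw [hp e he i hi, hprod, Finset.sum_eq_single_of_mem i hi fun j _ hj => if_neg fun h => hj ?_,
        if_pos rfl, Nat.multinomial_single]
      · ring
      · exact Finset.singleton_injective (by
          rw [← filter_single_ne_zero i two_ne_zero, h, filter_single_ne_zero j two_ne_zero])
    · have hle : ∀ i ∈ e, γ i ≤ 1 := by
        by_contra! ⟨i, hi, hi2⟩
        exact hsingle ⟨i, hi, eq_single_of_mem_piAntidiag hγ hi hi2⟩
      rw [hc e he γ hγ hle, multinomial_eq_factorial_of_le_one hle, (Finset.mem_piAntidiag.1 hγ).1,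
        Finset.sum_eq_zero fun i hi => if_neg fun h => hsingle ⟨i, hi, h⟩, Nat.factorial_two,
        Nat.cast_two]
      ring
  rw [← he, edgeSum_card_add, he, Finset.sum_congr rfl hterm, Finset.sum_add_distrib,
    ← Finset.mul_sum, ← Finset.sum_pow_eq_sum_piAntidiag, Finset.sum_comm, Finset.mul_sum]
  congr 1
  refine Finset.sum_congr rfl fun i hi => ?_
  rw [Finset.sum_ite_eq', if_pos ?_]
  exact Finset.mem_piAntidiag.2 ⟨by simp [hi], fun j hj => by
    by_contra hje
    exact hj (Pi.single_eq_of_ne (fun h : j = i => hje (h ▸ hi)) _)⟩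

end OrderedField

end EdgeSum

section TwoValues

variable {ι κ : Type*} {s : Finset ι} {t : Finset κ} {f : ι → ℕ} {g : κ → ℕ} {c : ℕ}

theorem sum_comp_of_eq_or_eq_succ {R : Type*} [CommRing R] (hf : ∀ x ∈ s, f x = c ∨ f x = c + 1)
    (φ : ℕ → R) : ∑ x ∈ s, φ (f x) =
      s.card * φ c + (((∑ x ∈ s, f x : ℕ) : R) - s.card * c) * (φ (c + 1) - φ c) := by
  have hφ : ∀ x ∈ s, φ (f x) = φ c + ((f x : R) - c) * (φ (c + 1) - φ c) := fun x hx => by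
    obtain h | h := hf x hx
    · rw [h, sub_self, zero_mul, add_zero]
    · rw [h]
      push_cast
      ring
  rw [Finset.sum_congr rfl hφ, Finset.sum_add_distrib, ← Finset.sum_mul, Finset.sum_sub_distrib,
    Finset.sum_const, Finset.sum_const, nsmul_eq_mul, nsmul_eq_mul, Nat.cast_sum]

theorem sum_sub_mul_sub_succ (s : Finset ι) (f : ι → ℕ) (c : ℕ) :
    ∑ x ∈ s, ((f x : ℤ) - c) * (f x - (c + 1)) =
      ((∑ x ∈ s, f x ^ 2 : ℕ) : ℤ) - (2 * c + 1) * ((∑ x ∈ s, f x : ℕ) : ℤ) +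
        s.card * (c * (c + 1)) := by
  push_cast
  rw [Finset.mul_sum, ← Finset.sum_sub_distrib, ← nsmul_eq_mul, ← Finset.sum_const,
    ← Finset.sum_add_distrib]
  exact Finset.sum_congr rfl fun x _ => by ring

/- The integer polynomial `(x - c) * (x - (c + 1))` is nonnegative, and vanishes at `c` and `c + 1`
only. -/
theorem sum_sq_lt_sum_sq_of_eq_or_eq_succ (hcard : s.card = t.card)
    (hsum : ∑ x ∈ s, f x = ∑ y ∈ t, g y) (hf : ∀ x ∈ s, f x = c ∨ f x = c + 1) {y : κ} (hy : y ∈ t)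
    (hyc : g y ≠ c) (hyc' : g y ≠ c + 1) : ∑ x ∈ s, f x ^ 2 < ∑ y ∈ t, g y ^ 2 := by
  have hzero : ∑ x ∈ s, ((f x : ℤ) - c) * (f x - (c + 1)) = 0 := Finset.sum_eq_zero fun x hx => by
    obtain h | h := hf x hx <;> simp [h]
  have hpos (x : ℕ) (hc : x ≠ c) (hc' : x ≠ c + 1) : 0 < ((x : ℤ) - c) * (x - (c + 1)) := by
    obtain h | h : x < c ∨ c + 1 < x := by omega
    · exact mul_pos_of_neg_of_neg (by omega) (by omega)
    · exact mul_pos (by omega) (by omega)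
  have hnonneg (x : ℕ) : 0 ≤ ((x : ℤ) - c) * (x - (c + 1)) := by
    by_cases hc : x = c
    · simp [hc]
    · by_cases hc' : x = c + 1
      · simp [hc']
      · exact (hpos x hc hc').le
  have hsum_pos : 0 < ∑ y ∈ t, ((g y : ℤ) - c) * (g y - (c + 1)) :=
    Finset.sum_pos' (fun x _ => hnonneg (g x)) ⟨y, hy, hpos (g y) hyc hyc'⟩
  have hdiff := hzero.trans_lt hsum_pos
  rw [sum_sub_mul_sub_succ, sum_sub_mul_sub_succ, hsum, hcard] at hdiff
  have : ((∑ x ∈ s, f x ^ 2 : ℕ) : ℤ) < (∑ y ∈ t, g y ^ 2 : ℕ) := by linarith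
  exact_mod_cast this

end TwoValues

section DegreeSums

variable {ι : Type*} [DecidableEq ι] {E : Finset (Finset ι)} {k : ℕ}

/-- The sum of the degrees of the vertices of `e`. -/
def edgeDegreeSum (E : Finset (Finset ι)) (e : Finset ι) : ℕ := ∑ v ∈ e, edgeDegree E v

theorem sum_mul_edgeDegree {R : Type*} [CommSemiring R] (E : Finset (Finset ι)) (e : Finset ι)
    (α : R) : ∑ i ∈ e, α * edgeDegree E i = α * edgeDegreeSum E e := by
  rw [edgeDegreeSum, Nat.cast_sum, Finset.mul_sum]

theorem sum_sum_edge [Fintype ι] {R : Type*} [CommSemiring R] (E : Finset (Finset ι))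
    (g : ι → R) : ∑ e ∈ E, ∑ i ∈ e, g i = ∑ i, edgeDegree E i * g i := by
  simp_rw [edgeDegree, ← nsmul_eq_mul, ← Finset.sum_const]
  exact Finset.sum_comm' fun e i => by simp

theorem sum_edgeDegree [Fintype ι] (hE : ∀ e ∈ E, e.card = k) :
    ∑ i, edgeDegree E i = E.card * k := by
  have h := sum_sum_edge E fun _ => (1 : ℕ)
  simp only [Finset.sum_const, smul_eq_mul, mul_one, Nat.cast_id] at h
  rw [← h, Finset.sum_congr rfl hE, Finset.sum_const, smul_eq_mul]

theorem sum_edgeDegreeSum [Fintype ι] (E : Finset (Finset ι)) :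
    ∑ e ∈ E, edgeDegreeSum E e = ∑ i, edgeDegree E i ^ 2 := by
  simp only [edgeDegreeSum, sum_sum_edge, Nat.cast_id, sq]

theorem edgeDegreeSum_eq_sum_card_inter (E : Finset (Finset ι)) (e : Finset ι) :
    edgeDegreeSum E e = ∑ f ∈ E, (f ∩ e).card := by
  simp_rw [edgeDegreeSum, edgeDegree, Finset.card_eq_sum_ones]
  exact Finset.sum_comm' fun v f => by simp only [Finset.mem_filter, Finset.mem_inter]; tauto

theorem card_add_card_le_edgeDegreeSum {e : Finset ι} (he : e ∈ E) {A : Finset (Finset ι)}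
    (hA : ∀ f ∈ A, f ∈ E ∧ f ≠ e ∧ ¬Disjoint f e) : e.card + A.card ≤ edgeDegreeSum E e := by
  have heA : e ∉ A := fun h => (hA e h).2.1 rfl
  have hsub : insert e A ⊆ E := Finset.insert_subset he fun f hf => (hA f hf).1
  calc e.card + A.card ≤ (e ∩ e).card + ∑ f ∈ A, (f ∩ e).card := by
        rw [Finset.inter_self, Finset.card_eq_sum_ones A]
        gcongr with f hf
        exact Finset.card_pos.2 (Finset.not_disjoint_iff_nonempty_inter.1 (hA f hf).2.2)
    _ = ∑ f ∈ insert e A, (f ∩ e).card := by rw [Finset.sum_insert heA]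
    _ ≤ edgeDegreeSum E e := by
        rw [edgeDegreeSum_eq_sum_card_inter]
        exact Finset.sum_le_sum_of_subset hsub

end DegreeSums

section Comparison

variable {ι : Type*} [DecidableEq ι] {E F : Finset (Finset ι)} {k : ℕ}
variable {R : Type*} [Field R]

theorem sum_edgeDegree_comp_eq [Fintype ι] (hE : ∀ e ∈ E, e.card = k) (hF : ∀ e ∈ F, e.card = k)
    (hcard : E.card = F.card) (hEdeg : ∀ i, edgeDegree E i = 1 ∨ edgeDegree E i = 2)
    (hFdeg : ∀ i, edgeDegree F i = 1 ∨ edgeDegree F i = 2) (φ : ℕ → R) :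
    ∑ i, φ (edgeDegree E i) = ∑ i, φ (edgeDegree F i) := by
  rw [sum_comp_of_eq_or_eq_succ (fun i _ => hEdeg i), sum_comp_of_eq_or_eq_succ fun i _ => hFdeg i,
    sum_edgeDegree hE, sum_edgeDegree hF, hcard]

theorem sum_edgeDegreeSum_eq [Finite ι] (hE : ∀ e ∈ E, e.card = k) (hF : ∀ e ∈ F, e.card = k)
    (hcard : E.card = F.card) (hEdeg : ∀ i, edgeDegree E i = 1 ∨ edgeDegree E i = 2)
    (hFdeg : ∀ i, edgeDegree F i = 1 ∨ edgeDegree F i = 2) :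
    ∑ e ∈ E, edgeDegreeSum E e = ∑ e ∈ F, edgeDegreeSum F e := by
  cases nonempty_fintype ι
  have h := sum_edgeDegree_comp_eq hE hF hcard hEdeg hFdeg fun x => (x : ℚ) ^ 2
  rw [sum_edgeDegreeSum, sum_edgeDegreeSum]
  exact_mod_cast h

variable [Fintype ι] [LinearOrder R] [IsStrictOrderedRing R]

theorem trace_edgeTensor_of_lt (hk : 2 ≤ k) (hcut : HasCuts E) (hE : ∀ e ∈ E, e.card = k) (α : R)
    {d : ℕ} (hd0 : d ≠ 0) (hd : d < k) : trace d (edgeTensor k E α) =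
      ((k : R) - 1) ^ (Fintype.card ι - 1) * (α ^ d * ∑ i, (edgeDegree E i : R) ^ d) := by
  rw [trace_edgeTensor hk hcut hE α hd0 (by omega),
    Finset.sum_eq_zero fun e he => edgeSum_eq_zero (hd.trans_eq (hE e he).symm) _, mul_zero,
    add_zero]
  simp only [mul_pow, ← Finset.mul_sum]

theorem trace_edgeTensor_eq_of_lt_two (hk : 2 ≤ k) (hEcut : HasCuts E) (hFcut : HasCuts F)
    (hE : ∀ e ∈ E, e.card = k) (hF : ∀ e ∈ F, e.card = k) (hcard : E.card = F.card) (α : R)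
    {d : ℕ} (hd : d < 2) : trace d (edgeTensor k E α) = trace d (edgeTensor k F α) := by
  obtain rfl | rfl : d = 0 ∨ d = 1 := by omega
  · rw [trace_zero, trace_zero]
  · rw [trace_edgeTensor_of_lt hk hEcut hE α one_ne_zero (by omega),
      trace_edgeTensor_of_lt hk hFcut hF α one_ne_zero (by omega)]
    simp only [pow_one]
    rw [← Nat.cast_sum, ← Nat.cast_sum, sum_edgeDegree hE, sum_edgeDegree hF, hcard]

theorem sum_edgeSum_eq (hk : k ≠ 0) (hE : ∀ e ∈ E, e.card = k) (hF : ∀ e ∈ F, e.card = k)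
    (hcard : E.card = F.card) (hEdeg : ∀ i, edgeDegree E i = 1 ∨ edgeDegree E i = 2)
    (hFdeg : ∀ i, edgeDegree F i = 1 ∨ edgeDegree F i = 2) (α : R) {d : ℕ} (hd : d < k + 2) :
    ∑ e ∈ E, edgeSum k d e (fun i => α * edgeDegree E i) =
      ∑ e ∈ F, edgeSum k d e fun i => α * edgeDegree F i := by
  by_cases hdk : d < k
  · rw [Finset.sum_eq_zero fun e he => edgeSum_eq_zero (hdk.trans_eq (hE e he).symm) _,
      Finset.sum_eq_zero fun e he => edgeSum_eq_zero (hdk.trans_eq (hF e he).symm) _]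
  obtain ⟨n, rfl⟩ := Nat.exists_eq_add_of_le (not_lt.1 hdk)
  obtain ⟨c, hc⟩ := exists_edgeSum_eq_mul_pow ι R hk (n := n) (by omega)
  rw [Finset.sum_congr rfl fun e he => hc e (hE e he) _,
    Finset.sum_congr rfl fun e he => hc e (hF e he) _]
  simp only [sum_mul_edgeDegree]
  obtain rfl | rfl : n = 0 ∨ n = 1 := by omega
  · simp [hcard]
  · simp only [pow_one]
    rw [← Finset.mul_sum, ← Finset.mul_sum, ← Finset.mul_sum, ← Finset.mul_sum, ← Nat.cast_sum,
      ← Nat.cast_sum, sum_edgeDegreeSum_eq hE hF hcard hEdeg hFdeg]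

theorem trace_edgeTensor_eq_of_lt_add_two (hk : 3 ≤ k) (hEcut : HasCuts E) (hFcut : HasCuts F)
    (hE : ∀ e ∈ E, e.card = k) (hF : ∀ e ∈ F, e.card = k) (hcard : E.card = F.card)
    (hEdeg : ∀ i, edgeDegree E i = 1 ∨ edgeDegree E i = 2)
    (hFdeg : ∀ i, edgeDegree F i = 1 ∨ edgeDegree F i = 2) (α : R) {d : ℕ} (hd : d < k + 2) :
    trace d (edgeTensor k E α) = trace d (edgeTensor k F α) := by
  by_cases hd0 : d = 0
  · rw [hd0, trace_zero, trace_zero]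
  rw [trace_edgeTensor (by omega) hEcut hE α hd0 (by omega),
    trace_edgeTensor (by omega) hFcut hF α hd0 (by omega),
    sum_edgeSum_eq (by omega) hE hF hcard hEdeg hFdeg α hd,
    sum_edgeDegree_comp_eq hE hF hcard hEdeg hFdeg fun x => (α * x) ^ d]

theorem pow_natCast_sub_one_pos (hk : 2 ≤ k) (n : ℕ) : 0 < ((k : R) - 1) ^ n := by
  have : (2 : R) ≤ k := by exact_mod_cast hk
  exact pow_pos (by linarith) n

theorem trace_edgeTensor_two_lt (hk : 3 ≤ k) (hEcut : HasCuts E) (hFcut : HasCuts F)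
    (hE : ∀ e ∈ E, e.card = k) (hF : ∀ e ∈ F, e.card = k) (hcard : E.card = F.card)
    (hEdeg : ∀ i, edgeDegree E i = 1 ∨ edgeDegree E i = 2) {v : ι} (hv : 2 < edgeDegree F v)
    {α : R} (hα : α ≠ 0) : trace 2 (edgeTensor k E α) < trace 2 (edgeTensor k F α) := by
  have hlt := sum_sq_lt_sum_sq_of_eq_or_eq_succ (s := Finset.univ) (f := edgeDegree E)
    (g := edgeDegree F) rfl (by rw [sum_edgeDegree hE, sum_edgeDegree hF, hcard])
    (fun i _ => hEdeg i) (Finset.mem_univ v) (by omega) (by omega)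
  rw [trace_edgeTensor_of_lt (by omega) hEcut hE α two_ne_zero (by omega),
    trace_edgeTensor_of_lt (by omega) hFcut hF α two_ne_zero (by omega)]
  refine mul_lt_mul_of_pos_left (mul_lt_mul_of_pos_left ?_ (by positivity))
    (pow_natCast_sub_one_pos (by omega) _)
  exact_mod_cast hlt

theorem sum_edgeSum_add_two_lt (hk : k ≠ 0) (hE : ∀ e ∈ E, e.card = k)
    (hF : ∀ e ∈ F, e.card = k) (hcard : E.card = F.card)
    (hEdeg : ∀ i, edgeDegree E i = 1 ∨ edgeDegree E i = 2)
    (hFdeg : ∀ i, edgeDegree F i = 1 ∨ edgeDegree F i = 2)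
    (hEsum : ∀ e ∈ E, edgeDegreeSum E e = k + 1 ∨ edgeDegreeSum E e = k + 2) {f : Finset ι}
    (hf : f ∈ F) (hfsum : k + 2 < edgeDegreeSum F f) {α : R} (hα : α ≠ 0) :
    ∑ e ∈ E, edgeSum k (k + 2) e (fun i => α * edgeDegree E i) <
      ∑ e ∈ F, edgeSum k (k + 2) e fun i => α * edgeDegree F i := by
  obtain ⟨a, b, ha, hab⟩ := exists_edgeSum_add_two ι R hk
  have hlt := sum_sq_lt_sum_sq_of_eq_or_eq_succ hcard
    (sum_edgeDegreeSum_eq hE hF hcard hEdeg hFdeg) hEsum hf (by omega) (by omega)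
  have hsq : ∑ i, (edgeDegree E i : R) * (α * edgeDegree E i) ^ 2 =
      ∑ i, (edgeDegree F i : R) * (α * edgeDegree F i) ^ 2 :=
    sum_edgeDegree_comp_eq hE hF hcard hEdeg hFdeg fun x => (x : R) * (α * x) ^ 2
  rw [Finset.sum_congr rfl fun e he => hab e (hE e he) _,
    Finset.sum_congr rfl fun e he => hab e (hF e he) _]
  simp only [sum_mul_edgeDegree, mul_pow α (Nat.cast (edgeDegreeSum _ _)) 2]
  rw [Finset.sum_add_distrib, Finset.sum_add_distrib, ← Finset.mul_sum, ← Finset.mul_sum,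
    ← Finset.mul_sum, ← Finset.mul_sum, ← Finset.mul_sum, ← Finset.mul_sum, sum_sum_edge,
    sum_sum_edge, hsq]
  refine add_lt_add_left (mul_lt_mul_of_pos_left (mul_lt_mul_of_pos_left ?_ (by positivity)) ha) _
  exact_mod_cast hlt

theorem trace_edgeTensor_add_two_lt (hk : 3 ≤ k) (hEcut : HasCuts E) (hFcut : HasCuts F)
    (hE : ∀ e ∈ E, e.card = k) (hF : ∀ e ∈ F, e.card = k) (hcard : E.card = F.card)
    (hEdeg : ∀ i, edgeDegree E i = 1 ∨ edgeDegree E i = 2)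
    (hFdeg : ∀ i, edgeDegree F i = 1 ∨ edgeDegree F i = 2)
    (hEsum : ∀ e ∈ E, edgeDegreeSum E e = k + 1 ∨ edgeDegreeSum E e = k + 2) {f : Finset ι}
    (hf : f ∈ F) (hfsum : k + 2 < edgeDegreeSum F f) {α : R} (hα : α ≠ 0)
    (hα' : 0 < (1 - α) ^ k) :
    trace (k + 2) (edgeTensor k E α) < trace (k + 2) (edgeTensor k F α) := by
  rw [trace_edgeTensor (by omega) hEcut hE α (by omega) (by omega),
    trace_edgeTensor (by omega) hFcut hF α (by omega) (by omega),
    sum_edgeDegree_comp_eq hE hF hcard hEdeg hFdeg fun x => (α * x) ^ (k + 2)]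
  gcongr
  · exact pow_natCast_sub_one_pos (by omega) _
  · exact sum_edgeSum_add_two_lt (by omega) hE hF hcard hEdeg hFdeg hEsum hf hfsum hα

end Comparison

end HTensor

/-! ### Trees of edges -/

section Tree

open HTensor

variable {ι : Type*} {E : Finset (Finset ι)}

/-- The set family `E` is a connected hypergraph on `ι` without Berge cycles. -/
structure IsEdgeTree (E : Finset (Finset ι)) : Prop where
  nonempty : Nonempty ι
  connected : ∀ u v, Relation.ReflTransGen (fun u v => ∃ e ∈ E, u ∈ e ∧ v ∈ e) u v
  acyclic : ∀ (l : ℕ) (v : Fin (l + 2) → ι) (e : Fin (l + 2) → Finset ι), Function.Injective v →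
    Function.Injective e → ¬ ∀ i, e i ∈ E ∧ v i ∈ e i ∧ v (i + 1) ∈ e i

/-- The bipartite graph of the incident pairs of vertices and edges. -/
def incidenceGraph (E : Finset (Finset ι)) : SimpleGraph (ι ⊕ E) where
  Adj
    | .inl v, .inr e => v ∈ e.1
    | .inr e, .inl v => v ∈ e.1
    | _, _ => False
  symm := ⟨by rintro (u | e) (v | f) h <;> exact h⟩
  loopless := ⟨by rintro (u | e) h <;> exact h⟩

namespace incidenceGraph

theorem adj_inl_inr {v : ι} {e : E} :
    (incidenceGraph E).Adj (.inl v) (.inr e) ↔ v ∈ e.1 := Iff.rfl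

theorem adj_inr_inl {v : ι} {e : E} :
    (incidenceGraph E).Adj (.inr e) (.inl v) ↔ v ∈ e.1 := Iff.rfl

theorem not_adj_inl_inl {u v : ι} : ¬ (incidenceGraph E).Adj (.inl u) (.inl v) := id

theorem not_adj_inr_inr {e f : E} : ¬ (incidenceGraph E).Adj (.inr e) (.inr f) := id

theorem isLeft_getVert {u : ι} {y : ι ⊕ E} (c : (incidenceGraph E).Walk (.inl u) y) {i : ℕ}
    (hi : i ≤ c.length) : (c.getVert i).isLeft = (i % 2 == 0) := by
  induction i with
  | zero => simp
  | succ i ih =>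
    have hadj := c.adj_getVert_succ (i := i) (by omega)
    have ih := ih (by omega)
    generalize c.getVert i = x at hadj ih
    generalize c.getVert (i + 1) = z at hadj ⊢
    rcases x with v | e <;> rcases z with w | f
    · exact absurd hadj not_adj_inl_inl
    · simp at ih ⊢; omega
    · simp at ih ⊢; omega
    · exact absurd hadj not_adj_inr_inr

theorem exists_getVert_eq_inl {u : ι} {y : ι ⊕ E} (c : (incidenceGraph E).Walk (.inl u) y) {i : ℕ}
    (hi : 2 * i ≤ c.length) : ∃ v, c.getVert (2 * i) = .inl v :=
  Sum.isLeft_iff.1 <| by simp [isLeft_getVert c hi]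

theorem exists_getVert_eq_inr {u : ι} {y : ι ⊕ E} (c : (incidenceGraph E).Walk (.inl u) y) {i : ℕ}
    (hi : 2 * i + 1 ≤ c.length) : ∃ e, c.getVert (2 * i + 1) = .inr e :=
  Sum.isRight_iff.1 <| by
    rw [← Sum.not_isLeft, isLeft_getVert c hi, Nat.mul_add_mod]
    decide

theorem degree_inl [DecidableEq ι] (v : ι)
    [Fintype ((incidenceGraph E).neighborSet (.inl v))] :
    (incidenceGraph E).degree (.inl v) = edgeDegree E v := by
  have hneighbors : (incidenceGraph E).neighborFinset (.inl v) =
      (E.attach.filter fun e => v ∈ e.1).map ⟨Sum.inr, Sum.inr_injective⟩ := by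
    ext x
    rw [SimpleGraph.mem_neighborFinset]
    rcases x with w | e
    · simp [not_adj_inl_inl]
    · simp [adj_inl_inr]
  rw [← SimpleGraph.card_neighborFinset_eq_degree, hneighbors, Finset.card_map, edgeDegree,
    Finset.filter_attach (v ∈ ·) E, Finset.card_map, Finset.card_attach]

theorem degree_inr (e : E) [Fintype ((incidenceGraph E).neighborSet (.inr e))] :
    (incidenceGraph E).degree (.inr e) = e.1.card := by
  have hneighbors : (incidenceGraph E).neighborFinset (.inr e) =
      e.1.map ⟨Sum.inl, Sum.inl_injective⟩ := by
    ext x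
    rw [SimpleGraph.mem_neighborFinset]
    rcases x with w | f
    · simp [adj_inr_inl]
    · simp [not_adj_inr_inr]
  rw [← SimpleGraph.card_neighborFinset_eq_degree, hneighbors, Finset.card_map]

end incidenceGraph

namespace IsEdgeTree

theorem not_isCycle_inl (h : IsEdgeTree E) {u : ι}
    (c : (incidenceGraph E).Walk (.inl u) (.inl u)) : ¬ c.IsCycle := by
  intro hc
  have hlength := hc.three_le_length
  have heven : c.length % 2 = 0 := by simpa using incidenceGraph.isLeft_getVert c le_rfl
  obtain ⟨l, hl⟩ : ∃ l, c.length = 2 * (l + 2) := ⟨c.length / 2 - 2, by omega⟩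
  have hv (i : Fin (l + 2)) := incidenceGraph.exists_getVert_eq_inl c (i := i) (by omega)
  have he (i : Fin (l + 2)) := incidenceGraph.exists_getVert_eq_inr c (i := i) (by omega)
  choose v hv using hv
  choose e he using he
  have hsucc (i : Fin (l + 2)) : c.getVert (2 * i.1 + 2) = .inl (v (i + 1)) := by
    rw [← hv]
    by_cases hi : i = Fin.last (l + 1)
    · subst hi
      have : 2 * (Fin.last (l + 1)).1 + 2 = c.length := by simp; omega
      rw [this, c.getVert_length]
      simp
    · rw [Fin.val_add_one, if_neg hi, mul_add]
  have hinj {i j : ℕ} (hi : i < c.length) (hj : j < c.length) (h : c.getVert i = c.getVert j) :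
      i = j := hc.getVert_injOn' (by simp only [Set.mem_ofPred_eq]; omega)
    (by simp only [Set.mem_ofPred_eq]; omega) h
  refine h.acyclic l v (fun i => (e i).1) (fun i j hij => ?_) (fun i j hij => ?_) fun i => ?_
  · have := hinj (i := 2 * i) (j := 2 * j) (by omega) (by omega) (by rw [hv, hv, hij])
    exact Fin.ext (by omega)
  · have := hinj (i := 2 * i + 1) (j := 2 * j + 1) (by omega) (by omega)
      (by rw [he, he, Subtype.ext hij])
    exact Fin.ext (by omega)
  · have hfst := c.adj_getVert_succ (i := 2 * i.1) (by omega)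
    have hsnd := c.adj_getVert_succ (i := 2 * i.1 + 1) (by omega)
    rw [hv, he] at hfst
    rw [he, hsucc] at hsnd
    exact ⟨(e i).2, hfst, hsnd⟩

theorem isAcyclic_incidenceGraph (h : IsEdgeTree E) : (incidenceGraph E).IsAcyclic := by
  classical
  rintro (u | e) c hc
  · exact h.not_isCycle_inl c hc
  · have hlength := hc.three_le_length
    have hadj := c.adj_getVert_succ (i := 0) (by omega)
    have hmem := c.getVert_mem_support 1
    rw [c.getVert_zero] at hadj
    rcases hx : c.getVert (0 + 1) with v | f
    · rw [zero_add] at hx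
      rw [hx] at hmem
      exact h.not_isCycle_inl _ (hc.rotate hmem)
    · rw [hx] at hadj
      exact incidenceGraph.not_adj_inr_inr hadj

theorem isTree_incidenceGraph (h : IsEdgeTree E) (hne : ∀ e ∈ E, e.Nonempty) :
    (incidenceGraph E).IsTree := by
  have hvertices (u v : ι) : (incidenceGraph E).Reachable (.inl u) (.inl v) := by
    induction h.connected u v with
    | refl => exact SimpleGraph.Reachable.refl _
    | tail _ hstep ih =>
      obtain ⟨e, he, hu, hv⟩ := hstep
      exact (ih.trans (incidenceGraph.adj_inl_inr (e := ⟨e, he⟩).2 hu).reachable).trans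
        (incidenceGraph.adj_inr_inl (e := ⟨e, he⟩).2 hv).reachable
  have hvertex (x : ι ⊕ E) : ∃ v, (incidenceGraph E).Reachable x (.inl v) := by
    rcases x with v | e
    · exact ⟨v, SimpleGraph.Reachable.refl _⟩
    · obtain ⟨v, hv⟩ := hne e.1 e.2
      exact ⟨v, (incidenceGraph.adj_inr_inl.2 hv).reachable⟩
  have := h.nonempty
  refine ⟨(SimpleGraph.connected_iff _).2 ⟨fun x y => ?_, inferInstance⟩,
    h.isAcyclic_incidenceGraph⟩
  obtain ⟨u, hu⟩ := hvertex x
  obtain ⟨v, hv⟩ := hvertex y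
  exact (hu.trans (hvertices u v)).trans hv.symm

theorem exists_not_disjoint (h : IsEdgeTree E) (hne : ∀ e ∈ E, e.Nonempty)
    {A : Finset (Finset ι)} (hA : A ⊂ E) (hA0 : A.Nonempty) :
    ∃ e ∈ A, ∃ f ∈ E, f ∉ A ∧ ¬Disjoint f e := by
  by_contra! hdisj
  have hclosed {e f : Finset ι} {w : ι} (he : e ∈ A) (hf : f ∈ E) (hwe : w ∈ e) (hwf : w ∈ f) :
      f ∈ A := by
    by_contra hfA
    exact Finset.disjoint_left.1 (hdisj e he f hf hfA) hwf hwe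
  obtain ⟨e, he⟩ := hA0
  obtain ⟨f, hf, hfA⟩ := Finset.exists_of_ssubset hA
  obtain ⟨u, hu⟩ := hne e (hA.1 he)
  obtain ⟨v, hv⟩ := hne f hf
  have hcover (v : ι) : ∃ e ∈ A, v ∈ e := by
    induction h.connected u v with
    | refl => exact ⟨e, he, hu⟩
    | tail _ hstep ih =>
      obtain ⟨g, hg, hwg, hvg⟩ := hstep
      obtain ⟨e', he', hwe'⟩ := ih
      exact ⟨g, hclosed he' hg hwe' hwg, hvg⟩
  obtain ⟨e', he', hv'⟩ := hcover v
  exact hfA (hclosed he' hf hv' hv)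

theorem card_eq [Fintype ι] {k : ℕ} (h : IsEdgeTree E) (hk : 1 ≤ k) (hE : ∀ e ∈ E, e.card = k) :
    Fintype.card ι = E.card * (k - 1) + 1 := by
  classical
  have htree := h.isTree_incidenceGraph fun e he => Finset.card_pos.1 (by rw [hE e he]; omega)
  have hedges := htree.card_edgeFinset
  have hdegrees := (incidenceGraph E).sum_degrees_eq_twice_card_edges
  rw [Fintype.sum_sum_type] at hdegrees
  simp only [incidenceGraph.degree_inl, incidenceGraph.degree_inr] at hdegrees
  rw [sum_edgeDegree hE, Finset.sum_coe_sort E Finset.card, Finset.sum_congr rfl hE,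
    Finset.sum_const, smul_eq_mul] at hdegrees
  rw [Fintype.card_sum, Fintype.card_coe] at hedges
  have hk : E.card * k = E.card * (k - 1) + E.card := by
    rw [← Nat.mul_succ, Nat.succ_eq_add_one, Nat.sub_add_cancel hk]
  omega

variable [DecidableEq ι]

theorem edgeDegree_pos (h : IsEdgeTree E) (hE0 : E.Nonempty) (hne : ∀ e ∈ E, e.Nonempty) (v : ι) :
    0 < edgeDegree E v := by
  rw [edgeDegree, Finset.card_pos]
  obtain ⟨e, he⟩ := hE0
  obtain ⟨u, hu⟩ := hne e he
  rcases (h.connected v u).cases_head with rfl | ⟨w, ⟨f, hf, hv, -⟩, -⟩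
  · exact ⟨e, by simp [he, hu]⟩
  · exact ⟨f, by simp [hf, hv]⟩

theorem card_lt_edgeDegreeSum (h : IsEdgeTree E) (hne : ∀ e ∈ E, e.Nonempty) (hE : 1 < E.card)
    {e : Finset ι} (he : e ∈ E) : e.card < edgeDegreeSum E e := by
  have hssub : {e} ⊂ E := by
    refine (Finset.singleton_subset_iff.2 he).ssubset_of_ne fun heq => ?_
    rw [← heq, Finset.card_singleton] at hE
    exact lt_irrefl 1 hE
  obtain ⟨e', he', f, hf, hfe, hdisj⟩ :=
    h.exists_not_disjoint hne hssub (Finset.singleton_nonempty e)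
  rw [Finset.mem_singleton] at he' hfe
  subst he'
  have hle := card_add_card_le_edgeDegreeSum he (A := {f})
    (by simpa only [Finset.mem_singleton, forall_eq] using ⟨hf, hfe, hdisj⟩)
  rwa [Finset.card_singleton] at hle

/- Deleting the incidence `v ∈ e` from the incidence tree separates `v` from the rest of `e`; the
cut set consists of the vertices on the side of `v`. -/
theorem hasCuts [Finite ι] (h : IsEdgeTree E) : HasCuts E := by
  cases nonempty_fintype ι
  classical
  intro e he v hv
  have hbridge := SimpleGraph.isAcyclic_iff_forall_adj_isBridge.1 h.isAcyclic_incidenceGraph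
    (incidenceGraph.adj_inl_inr (e := ⟨e, he⟩).2 hv)
  rw [SimpleGraph.isBridge_iff] at hbridge
  set G := (incidenceGraph E).deleteEdges {s(.inl v, .inr ⟨e, he⟩)} with hG
  refine ⟨Finset.univ.filter fun w => G.Reachable (.inl v) (.inl w), ?_, fun f hf hfe => ?_⟩
  · ext w
    simp only [Finset.mem_inter, Finset.mem_filter, Finset.mem_univ, true_and,
      Finset.mem_singleton]
    refine ⟨fun ⟨hr, hw⟩ => by_contra fun hwv => ?_, ?_⟩
    · refine hbridge (hr.trans (SimpleGraph.Adj.reachable ?_))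
      rw [hG, SimpleGraph.deleteEdges_adj]
      exact ⟨hw, by simp [hwv]⟩
    · rintro rfl
      exact ⟨SimpleGraph.Reachable.refl _, hv⟩
  · have hadj (w) (hw : w ∈ f) : G.Adj (.inl w) (.inr ⟨f, hf⟩) := by
      rw [hG, SimpleGraph.deleteEdges_adj]
      exact ⟨hw, by simp [hfe]⟩
    refine or_iff_not_imp_right.2 fun hdisj x hx => ?_
    obtain ⟨w, hw, hr⟩ := Finset.not_disjoint_iff.1 hdisj
    rw [Finset.mem_filter] at hr ⊢
    exact ⟨Finset.mem_univ _, (hr.2.trans (hadj w hw).reachable).trans (hadj x hx).symm.reachable⟩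

end IsEdgeTree

end Tree

section Chain

open HTensor

variable {ι : Type*} {E : Finset (Finset ι)}

/-- `l` lists distinct edges of `E`, any two consecutive ones of which intersect. -/
structure IsEdgeChain (E : Finset (Finset ι)) (l : List (Finset ι)) : Prop where
  nodup : l.Nodup
  mem : ∀ e ∈ l, e ∈ E
  isChain : l.IsChain fun e f => ¬Disjoint e f

namespace IsEdgeChain

variable {l l₁ l₂ : List (Finset ι)} {e f : Finset ι}

theorem nil (E : Finset (Finset ι)) : IsEdgeChain E [] :=
  ⟨List.nodup_nil, by simp, List.isChain_nil⟩

theorem cons (h : IsEdgeChain E (e :: l)) (hf : f ∈ E) (hfl : f ∉ e :: l) (hfe : ¬Disjoint f e) :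
    IsEdgeChain E (f :: e :: l) :=
  ⟨List.nodup_cons.2 ⟨hfl, h.nodup⟩, List.forall_mem_cons.2 ⟨hf, h.mem⟩,
    List.isChain_cons_cons.2 ⟨hfe, h.isChain⟩⟩

theorem reverse (h : IsEdgeChain E l) : IsEdgeChain E l.reverse :=
  ⟨List.nodup_reverse.2 h.nodup, fun e he => h.mem e (List.mem_reverse.1 he),
    List.isChain_reverse.2 (h.isChain.imp fun _ _ h' => fun h'' => h' h''.symm)⟩

theorem tail (h : IsEdgeChain E (e :: l)) : IsEdgeChain E l :=
  ⟨h.nodup.of_cons, fun f hf => h.mem f (List.mem_cons_of_mem e hf), h.isChain.tail⟩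

theorem exists_mem_forall_notMem {e : Finset ι} {l : List (Finset ι)} {k : ℕ}
    (hl : IsEdgeChain E (e :: l)) (hk : k ≠ 0) (hE : ∀ e ∈ E, e.card = k) :
    ∃ a ∈ e, ∀ f ∈ l.head?, a ∉ f := by
  have hcard := hE e (hl.mem e (by simp))
  obtain _ | ⟨f, l⟩ := l
  · obtain ⟨a, ha⟩ := Finset.card_pos.1 (by omega : 0 < e.card)
    exact ⟨a, ha, by simp⟩
  · have hef : e ≠ f := fun h => by simpa [h] using hl.nodup
    have hsub : ¬e ⊆ f := fun h => hef <| Finset.eq_of_subset_of_card_le h <| by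
      rw [hcard, hE f (hl.mem f (by simp))]
    simpa [Finset.not_subset] using hsub

variable [DecidableEq ι]

theorem card_add_three_le_edgeDegreeSum {p q : Finset ι}
    (h : IsEdgeChain E (l₁ ++ p :: e :: q :: l₂)) (hf : f ∈ E)
    (hfl : f ∉ l₁ ++ p :: e :: q :: l₂) (hfe : ¬Disjoint f e) : e.card + 3 ≤ edgeDegreeSum E e := by
  have hmem := h.mem
  have hnodup := (List.nodup_append.1 h.nodup).2.1
  have hchain := List.isChain_append.1 h.isChain |>.2.1
  simp only [List.mem_append, List.mem_cons, not_or] at hmem hfl hnodup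
  simp only [List.nodup_cons, List.mem_cons, not_or, List.isChain_cons_cons] at hnodup hchain
  have hcard : ({p, q, f} : Finset (Finset ι)).card = 3 := Finset.card_eq_three.2
    ⟨p, q, f, hnodup.1.2.1, Ne.symm hfl.2.1, Ne.symm hfl.2.2.2.1, rfl⟩
  rw [← hcard]
  refine card_add_card_le_edgeDegreeSum (hmem e (by simp)) ?_
  simp only [Finset.mem_insert, Finset.mem_singleton, forall_eq_or_imp, forall_eq]
  exact ⟨⟨hmem p (by simp), hnodup.1.1, hchain.1⟩,
    ⟨hmem q (by simp), Ne.symm hnodup.2.1.1, fun hd => hchain.2.1 hd.symm⟩, hf, hfl.2.2.1, hfe⟩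

end IsEdgeChain

theorem exists_image_Iic_eq {s : Finset ι} {n : ℕ} (hs : s.card = n + 1) {a z : ι} (ha : a ∈ s)
    (hz : z ∈ s) (haz : a ≠ z) : ∃ g : ℕ → ι, g 0 = a ∧ g n = z ∧ g '' Set.Iic n = s := by
  have hn : (0 : Fin (n + 1)) ≠ Fin.last n := by
    have := Finset.one_lt_card.2 ⟨a, ha, z, hz, haz⟩
    rw [Ne, Fin.ext_iff, Fin.val_zero, Fin.val_last]
    omega
  let e₀ : Fin (n + 1) ≃ s := (s.equivFinOfCardEq hs).symm.setValue 0 ⟨a, ha⟩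
  have he₀ : e₀ 0 = ⟨a, ha⟩ := Equiv.setValue_eq _ _ _
  let e : Fin (n + 1) ≃ s := e₀.setValue (Fin.last n) ⟨z, hz⟩
  have hlast : e (Fin.last n) = ⟨z, hz⟩ := Equiv.setValue_eq _ _ _
  have hzero : e 0 = ⟨a, ha⟩ := by
    refine (congrArg e₀ (Equiv.swap_apply_of_ne_of_ne hn fun h => haz ?_)).trans he₀
    rw [Equiv.eq_symm_apply, he₀] at h
    exact congrArg Subtype.val h
  refine ⟨fun x => e ⟨min x n, by omega⟩, by simp [hzero], ?_, ?_⟩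
  · simp only [min_self]
    exact congrArg Subtype.val hlast
  refine Set.Subset.antisymm (Set.image_subset_iff.2 fun x _ => (e ⟨min x n, by omega⟩).2) ?_
  exact fun v hv => ⟨e.symm ⟨v, hv⟩, Nat.lt_succ_iff.1 (Fin.is_lt _), by simp [Fin.is_le]⟩

/- The two maps overlap at `n`, the vertex shared by the first two blocks. -/
theorem exists_image_Icc_eq_getElem_cons {n : ℕ} {e : Finset ι} {l : List (Finset ι)}
    {g σ : ℕ → ι} (hg : g '' Set.Iic n = e) (hgσ : g n = σ 0)
    (hσ : ∀ i (hi : i < l.length), σ '' Set.Icc (i * n) ((i + 1) * n) = l[i]) :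
    ∃ τ : ℕ → ι, τ 0 = g 0 ∧
      ∀ i (hi : i < (e :: l).length), τ '' Set.Icc (i * n) ((i + 1) * n) = (e :: l)[i] := by
  let τ (x : ℕ) : ι := if x ≤ n then g x else σ (x - n)
  have hτ (x : ℕ) : τ (x + n) = σ x := by
    obtain rfl | hx := Nat.eq_zero_or_pos x
    · simp [τ, hgσ]
    · rw [show τ (x + n) = _ from if_neg (by omega), Nat.add_sub_cancel]
  refine ⟨τ, if_pos n.zero_le, fun i hi => ?_⟩
  obtain _ | i := i
  · rw [zero_mul, zero_add, one_mul, List.getElem_cons_zero, ← hg]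
    exact (congrArg (τ '' ·) Set.Icc_bot).trans (Set.image_congr fun x hx => if_pos hx)
  · rw [List.getElem_cons_succ, ← hσ i (by simpa using hi), ← funext hτ, ← Function.comp_def τ,
      Set.image_comp, Set.image_add_const_Icc]
    simp only [add_mul, one_mul]

variable [DecidableEq ι]

namespace IsEdgeTree

theorem exists_isEdgeChain_length_succ (h : IsEdgeTree E) (hne : ∀ e ∈ E, e.Nonempty)
    (hsum : ∀ e ∈ E, edgeDegreeSum E e ≤ e.card + 2) {l : List (Finset ι)} (hl : IsEdgeChain E l)
    (hlen : l.length < E.card) : ∃ l', IsEdgeChain E l' ∧ l'.length = l.length + 1 := by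
  have hssub : l.toFinset ⊂ E := by
    refine Finset.ssubset_iff_subset_ne.2
      ⟨fun e he => hl.mem e (List.mem_toFinset.1 he), ?_⟩
    rintro rfl
    exact hlen.not_ge l.toFinset_card_le
  obtain rfl | hl0 := eq_or_ne l []
  · obtain ⟨e, he, -⟩ := Finset.exists_of_ssubset hssub
    exact ⟨[e], ⟨List.nodup_singleton e, by simpa using he, List.isChain_singleton e⟩, rfl⟩
  obtain ⟨e, he, f, hf, hfl, hfe⟩ := h.exists_not_disjoint hne hssub
    (List.toFinset_nonempty_iff l |>.2 hl0)
  rw [List.mem_toFinset] at he hfl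
  obtain ⟨l₁, l₂, rfl⟩ := List.append_of_mem he
  obtain rfl | ⟨l₁, p, rfl⟩ := l₁.eq_nil_or_concat
  · exact ⟨f :: e :: l₂, hl.cons hf hfl hfe, rfl⟩
  obtain _ | ⟨q, l₂⟩ := l₂
  · have hrev := hl.reverse
    rw [← List.mem_reverse] at hfl
    rw [List.reverse_append, List.reverse_singleton, List.singleton_append] at hrev hfl
    exact ⟨f :: e :: (l₁.concat p).reverse, hrev.cons hf hfl hfe, by simp⟩
  · rw [List.concat_eq_append, List.append_assoc, List.singleton_append] at hl hfl
    have := hl.card_add_three_le_edgeDegreeSum hf hfl hfe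
    have := hsum e (hl.mem e (by simp))
    omega

theorem exists_isEdgeChain_toFinset_eq (h : IsEdgeTree E) (hne : ∀ e ∈ E, e.Nonempty)
    (hsum : ∀ e ∈ E, edgeDegreeSum E e ≤ e.card + 2) :
    ∃ l, IsEdgeChain E l ∧ l.toFinset = E := by
  have hlen : ∀ n ≤ E.card, ∃ l, IsEdgeChain E l ∧ l.length = n := by
    intro n hn
    induction n with
    | zero => exact ⟨[], IsEdgeChain.nil E, rfl⟩
    | succ n ih =>
      obtain ⟨l, hl, rfl⟩ := ih (by omega)
      exact h.exists_isEdgeChain_length_succ hne hsum hl hn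
  obtain ⟨l, hl, hcard⟩ := hlen _ le_rfl
  refine ⟨l, hl, Finset.eq_of_subset_of_card_le (fun e he => hl.mem e (List.mem_toFinset.1 he)) ?_⟩
  rw [List.toFinset_card_of_nodup hl.nodup, hcard]

end IsEdgeTree

theorem IsEdgeChain.notMem_of_mem {e f : Finset ι} {l : List (Finset ι)}
    (hl : IsEdgeChain E (e :: f :: l)) (hdeg : ∀ v, edgeDegree E v ≤ 2) {z : ι} (he : z ∈ e)
    (hf : z ∈ f) : ∀ g ∈ l.head?, z ∉ g := by
  intro g hg hzg
  have hgl := List.mem_of_mem_head? hg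
  have hnodup := hl.nodup
  simp only [List.nodup_cons, List.mem_cons, not_or] at hnodup
  have hcard : ({e, f, g} : Finset (Finset ι)).card = 3 := Finset.card_eq_three.2
    ⟨e, f, g, hnodup.1.1, fun h => hnodup.1.2 (h ▸ hgl), fun h => hnodup.2.1 (h ▸ hgl), rfl⟩
  have hsub : ({e, f, g} : Finset (Finset ι)) ⊆ E.filter (z ∈ ·) := by
    simp only [Finset.insert_subset_iff, Finset.singleton_subset_iff, Finset.mem_filter]
    exact ⟨⟨hl.mem e (by simp), he⟩, ⟨hl.mem f (by simp), hf⟩, hl.mem g (by simp [hgl]), hzg⟩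
  have := (Finset.card_le_card hsub).trans (hdeg z)
  omega

theorem exists_numbering_of_isEdgeChain {n : ℕ} (hn : n ≠ 0) (hE : ∀ e ∈ E, e.card = n + 1)
    (hdeg : ∀ v, edgeDegree E v ≤ 2) {e : Finset ι} {l : List (Finset ι)}
    (hl : IsEdgeChain E (e :: l)) {a : ι} (ha : a ∈ e) (hal : ∀ f ∈ l.head?, a ∉ f) :
    ∃ σ : ℕ → ι, σ 0 = a ∧
      ∀ i (hi : i < (e :: l).length), σ '' Set.Icc (i * n) ((i + 1) * n) = (e :: l)[i] := by
  have hcard := hE e (hl.mem e (by simp))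
  induction l generalizing e a with
  | nil =>
    obtain ⟨z, hz, hza⟩ := Finset.exists_mem_ne (by omega : 1 < e.card) a
    obtain ⟨g, rfl, -, hg⟩ := exists_image_Iic_eq hcard ha hz hza.symm
    exact exists_image_Icc_eq_getElem_cons (σ := fun _ => g n) hg rfl (by simp)
  | cons f l ih =>
    obtain ⟨z, hze, hzf⟩ := Finset.not_disjoint_iff.1 (List.isChain_cons_cons.1 hl.isChain).1
    have hza : a ≠ z := fun h => hal f (by simp) (h ▸ hzf)
    obtain ⟨g, rfl, hgz, hg⟩ := exists_image_Iic_eq hcard ha hze hza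
    obtain ⟨σ, hσz, hσ⟩ := ih hl.tail hzf (hl.notMem_of_mem hdeg hze hzf)
      (hE f (hl.mem f (by simp)))
    exact exists_image_Icc_eq_getElem_cons hg (hgz.trans hσz.symm) hσ

namespace IsEdgeTree

variable {k : ℕ}

theorem exists_mem_iff_image_Icc_eq (h : IsEdgeTree E) (hk : 2 ≤ k) (hE : ∀ e ∈ E, e.card = k)
    (hdeg : ∀ v, edgeDegree E v ≤ 2) (hsum : ∀ e ∈ E, edgeDegreeSum E e ≤ k + 2) :
    ∃ σ : ℕ → ι, ∀ e : Finset ι, e ∈ E ↔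
      ∃ i < E.card, σ '' Set.Icc (i * (k - 1)) ((i + 1) * (k - 1)) = e := by
  obtain ⟨l, hl, rfl⟩ := h.exists_isEdgeChain_toFinset_eq
    (fun e he => Finset.card_pos.1 (by rw [hE e he]; omega)) fun e he => by
      rw [hE e he]; exact hsum e he
  obtain ⟨σ, hσ⟩ : ∃ σ : ℕ → ι, ∀ i (hi : i < l.length),
      σ '' Set.Icc (i * (k - 1)) ((i + 1) * (k - 1)) = l[i] := by
    obtain _ | ⟨e, l⟩ := l
    · exact ⟨fun _ => h.nonempty.some, by simp⟩
    · obtain ⟨a, ha, hal⟩ := hl.exists_mem_forall_notMem (by omega) hE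
      obtain ⟨σ, -, hσ⟩ := exists_numbering_of_isEdgeChain (by omega : k - 1 ≠ 0)
        (fun e he => by rw [hE e he]; omega) hdeg hl ha hal
      exact ⟨σ, hσ⟩
  refine ⟨σ, fun e => ?_⟩
  rw [List.toFinset_card_of_nodup hl.nodup, List.mem_toFinset, List.mem_iff_getElem]
  exact exists_congr fun i => ⟨fun ⟨hi, hie⟩ => ⟨hi, by rw [hσ i hi, hie]⟩,
    fun ⟨hi, hie⟩ => ⟨hi, Finset.coe_injective ((hσ i hi).symm.trans hie)⟩⟩

theorem exists_bijOn_Iic [Finite ι] (h : IsEdgeTree E) (hk : 2 ≤ k) (hE : ∀ e ∈ E, e.card = k)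
    (hdeg : ∀ v, edgeDegree E v ≤ 2) (hsum : ∀ e ∈ E, edgeDegreeSum E e ≤ k + 2) :
    ∃ σ : ℕ → ι, Set.BijOn σ (Set.Iic (E.card * (k - 1))) Set.univ ∧ ∀ e : Finset ι, e ∈ E ↔
      ∃ i < E.card, σ '' Set.Icc (i * (k - 1)) ((i + 1) * (k - 1)) = e := by
  cases nonempty_fintype ι
  obtain ⟨σ, hσ⟩ := h.exists_mem_iff_image_Icc_eq hk hE hdeg hsum
  have hcard := h.card_eq (by omega) hE
  have hsurj : Set.SurjOn σ (Set.Iic (E.card * (k - 1))) Set.univ := fun v _ => by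
    obtain rfl | hE0 := E.eq_empty_or_nonempty
    · have : Subsingleton ι := Fintype.card_le_one_iff_subsingleton.1 (by simp [hcard])
      exact ⟨0, Nat.zero_le _, Subsingleton.elim _ _⟩
    · obtain ⟨e, he⟩ := Finset.card_pos.1 <| h.edgeDegree_pos hE0
        (fun e he => Finset.card_pos.1 (by rw [hE e he]; omega)) v
      obtain ⟨he, hv⟩ := Finset.mem_filter.1 he
      obtain ⟨i, hi, hie⟩ := (hσ e).1 he
      rw [← Finset.mem_coe, ← hie] at hv
      exact Set.image_mono (fun x hx => hx.2.trans (Nat.mul_le_mul_right _ hi)) hv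
  refine ⟨σ, ⟨Set.mapsTo_univ _ _, ?_, hsurj⟩, hσ⟩
  rw [← Finset.coe_Iic] at hsurj ⊢
  rw [← Finset.coe_univ] at hsurj
  refine Finset.injOn_of_surjOn_of_card_le σ (fun x _ => Finset.mem_univ (σ x)) hsurj ?_
  rw [Nat.card_Iic, Finset.card_univ, hcard]

end IsEdgeTree

end Chain

/-! ### Labeled hypergraphs -/

section Labeling

open HTensor Hypergraph

variable {ι V W : Type*} {H : Hypergraph V} {G : Hypergraph W} {k : ℕ}

theorem injective_labeling (σ : ι ≃ H.vertexSet) : Function.Injective fun i => (σ i : V) :=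
  Subtype.val_injective.comp σ.injective

theorem injective_image_labeling (σ : ι ≃ H.vertexSet) :
    Function.Injective fun e : Finset ι => (fun i => (σ i : V)) '' e :=
  (Set.image_injective.2 (injective_labeling σ)).comp Finset.coe_injective

variable [Fintype ι]

/-- The edges of `H` as sets of labels, where `σ` labels the vertices of `H` by `ι`. Hypergraphs
with equally many vertices become set families on the same finite type, as the comparison of
their traces requires. -/
noncomputable def labeledEdges (σ : ι ≃ H.vertexSet) : Finset (Finset ι) :=
  open Classical in Finset.univ.filter fun e => (fun i => (σ i : V)) '' e ∈ H.edgeSet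

variable {σ : ι ≃ H.vertexSet}

theorem mem_labeledEdges {e : Finset ι} :
    e ∈ labeledEdges σ ↔ (fun i => (σ i : V)) '' e ∈ H.edgeSet := by
  simp only [labeledEdges, Finset.mem_filter, Finset.mem_univ, true_and]

theorem exists_mem_labeledEdges (σ : ι ≃ H.vertexSet) {s : Set V} (hs : s ∈ H.edgeSet) :
    ∃ e ∈ labeledEdges σ, (fun i => (σ i : V)) '' e = s := by
  classical
  have himage : (fun i => (σ i : V)) '' (Finset.univ.filter fun i => (σ i : V) ∈ s : Finset ι) =
      s := by
    rw [Finset.coe_filter_univ]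
    refine Set.image_preimage_eq_of_subset fun v hv => ?_
    exact ⟨σ.symm ⟨v, H.subset_vertexSet_of_mem_edgeSet' hs hv⟩, by simp⟩
  exact ⟨_, mem_labeledEdges.2 (himage.symm ▸ hs), himage⟩

theorem image_labeledEdges (σ : ι ≃ H.vertexSet) :
    (fun e : Finset ι => (fun i => (σ i : V)) '' e) '' labeledEdges σ = H.edgeSet :=
  Set.Subset.antisymm (Set.image_subset_iff.2 fun _ => mem_labeledEdges.1)
    fun _ => exists_mem_labeledEdges σ

theorem card_labeledEdges (σ : ι ≃ H.vertexSet) : (labeledEdges σ).card = H.edgeSet.ncard := by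
  rw [← image_labeledEdges σ, Set.ncard_image_of_injective _ (injective_image_labeling σ),
    Set.ncard_coe_finset]

theorem card_eq_of_mem_labeledEdges (hH : H.IsUniform k) {e : Finset ι} (he : e ∈ labeledEdges σ) :
    e.card = k := by
  rw [← hH _ (mem_labeledEdges.1 he), Set.ncard_image_of_injective _ (injective_labeling σ),
    Set.ncard_coe_finset]

theorem edgeDegree_labeledEdges [DecidableEq ι] (σ : ι ≃ H.vertexSet) (i : ι) :
    edgeDegree (labeledEdges σ) i = H.degree (σ i) := by
  rw [edgeDegree, degree, ← Set.ncard_coe_finset,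
    ← Set.ncard_image_of_injective _ (injective_image_labeling σ)]
  congr 1
  ext s
  refine ⟨?_, fun ⟨hs, hi⟩ => ?_⟩
  · rintro ⟨e, he, rfl⟩
    obtain ⟨he, hi⟩ := Finset.mem_filter.1 he
    exact ⟨mem_labeledEdges.1 he, i, hi, rfl⟩
  · obtain ⟨e, he, rfl⟩ := exists_mem_labeledEdges σ hs
    obtain ⟨j, hj, hji⟩ := hi
    exact ⟨e, Finset.mem_coe.2 <|
      Finset.mem_filter.2 ⟨he, injective_labeling σ hji ▸ hj⟩, rfl⟩

theorem edgeDegreeSum_labeledEdges [DecidableEq ι] (σ : ι ≃ H.vertexSet) (e : Finset ι) :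
    edgeDegreeSum (labeledEdges σ) e =
      ∑ v ∈ e.map ⟨fun i => (σ i : V), injective_labeling σ⟩, H.degree v := by
  simp only [edgeDegreeSum, edgeDegree_labeledEdges, Finset.sum_map, Function.Embedding.coeFn_mk]

theorem alphaTrace_eq_trace_labeledEdges [DecidableEq ι] [Fintype H.vertexSet]
    (σ : ι ≃ H.vertexSet) (k : ℕ) (α : ℝ) (d : ℕ) :
    H.alphaTrace k α d = trace d (edgeTensor k (labeledEdges σ) α) := by
  refine (trace_reindex σ d fun i x => ?_).symm
  have himage : (fun i => (σ i : V)) '' (insert i (Finset.univ.image x) : Finset ι) =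
      insert (σ i : V) (Set.range fun j => (σ (x j) : V)) := by
    rw [Finset.coe_insert, Finset.coe_image, Finset.coe_univ, Set.image_univ, Set.image_insert_eq,
      ← Set.range_comp]
    rfl
  have hmem : insert i (Finset.univ.image x) ∈ labeledEdges σ ↔
      insert (σ i : V) (Set.range fun j => (σ (x j) : V)) ∈ H.edgeSet := by
    rw [mem_labeledEdges, himage]
  simp only [edgeTensor, alphaTensor, Pi.add_apply, Pi.smul_apply, smul_eq_mul, degTensor,
    adjTensor, edgeDegree_labeledEdges, Function.comp_apply, σ.injective.eq_iff]
  classical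
  congr 2
  exact if_congr hmem rfl rfl

theorem isEdgeTree_labeledEdges (hH : H.IsHypertree) (σ : ι ≃ H.vertexSet) :
    IsEdgeTree (labeledEdges σ) := by
  obtain ⟨⟨⟨x, hx⟩, hconn⟩, hacyclic⟩ := hH
  have hstep {i j : ι} (hadj : H.Adj (σ i) (σ j)) : ∃ e ∈ labeledEdges σ, i ∈ e ∧ j ∈ e := by
    obtain ⟨s, hs, hi, hj⟩ := hadj
    obtain ⟨e, he, rfl⟩ := exists_mem_labeledEdges σ hs
    exact ⟨e, he, (injective_labeling σ).mem_set_image.1 hi,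
      (injective_labeling σ).mem_set_image.1 hj⟩
  have hwalk (i : ι) {v : V} (h : Relation.ReflTransGen H.Adj (σ i) v) (j : ι)
      (hj : (σ j : V) = v) :
      Relation.ReflTransGen (fun i j => ∃ e ∈ labeledEdges σ, i ∈ e ∧ j ∈ e) i j := by
    induction h generalizing j with
    | refl => rw [injective_labeling σ hj]
    | @tail u v _ hadj ih =>
      obtain ⟨s, hs, hu, -⟩ := id hadj
      obtain ⟨l, hl⟩ := σ.surjective ⟨u, H.subset_vertexSet_of_mem_edgeSet' hs hu⟩
      have hlu : (σ l : V) = u := congrArg Subtype.val hl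
      exact (ih l hlu).tail (hstep (by rwa [hlu, hj]))
  refine ⟨⟨σ.symm ⟨x, hx⟩⟩, fun i j => hwalk i (hconn _ (σ i).2 _ (σ j).2) j rfl, ?_⟩
  intro l v e hv he hcycle
  refine hacyclic l (fun i => σ (v i)) (fun i => (fun i => (σ i : V)) '' e i)
    ⟨(injective_labeling σ).comp hv, (injective_image_labeling σ).comp he, fun i => ?_⟩
  obtain ⟨hmem, hi, hi'⟩ := hcycle i
  exact ⟨mem_labeledEdges.1 hmem, ⟨_, hi, rfl⟩, ⟨_, hi', rfl⟩⟩

theorem alphaEq_of_isIsomorphic [Fintype H.vertexSet] [Fintype G.vertexSet]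
    (h : H.IsIsomorphic G) (k : ℕ) (α : ℝ) : AlphaEq k α H G := by
  classical
  obtain ⟨τ, hτ⟩ := h
  have hedges : labeledEdges (Equiv.refl H.vertexSet) = labeledEdges τ := by
    ext e
    simpa only [mem_labeledEdges, Set.image_image, Equiv.refl_apply] using hτ e
  refine ⟨Fintype.card_congr τ, fun t _ => ?_⟩
  rw [alphaTrace_eq_trace_labeledEdges (Equiv.refl _), alphaTrace_eq_trace_labeledEdges τ, hedges]

end Labeling

/-! ### Hyperpaths -/

section Hyperpath

open HTensor Hypergraph

section Blocks

variable {n : ℕ}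

theorem ncard_Icc_mul (n i : ℕ) : (Set.Icc (i * n) ((i + 1) * n)).ncard = n + 1 := by
  rw [← Finset.coe_Icc, Set.ncard_coe_finset, Nat.card_Icc, Nat.succ_mul]
  omega

theorem injective_Icc_mul (hn : n ≠ 0) :
    Function.Injective fun i : ℕ => Set.Icc (i * n) ((i + 1) * n) := by
  intro i j hij
  have hle (i : ℕ) : i * n ≤ (i + 1) * n := Nat.mul_le_mul_right _ (Nat.le_succ i)
  refine Nat.eq_of_mul_eq_mul_right (Nat.pos_of_ne_zero hn) (le_antisymm ?_ ?_)
  · exact ((Set.Icc_subset_Icc_iff (hle j)).1 hij.ge).1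
  · exact ((Set.Icc_subset_Icc_iff (hle i)).1 hij.le).1

theorem eq_mul_of_mem_Icc_of_mem_Icc {i j x : ℕ} (hij : i < j)
    (hi : x ∈ Set.Icc (i * n) ((i + 1) * n)) (hj : x ∈ Set.Icc (j * n) ((j + 1) * n)) :
    x = j * n :=
  le_antisymm (hi.2.trans (Nat.mul_le_mul_right _ hij)) hj.1

end Blocks

variable {k m : ℕ}

theorem isUniform_hyperpath (hk : 1 ≤ k) : (hyperpath k m).IsUniform k := by
  rintro e ⟨i, -, rfl⟩
  rw [ncard_Icc_mul, Nat.sub_add_cancel hk]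

theorem ncard_edgeSet_hyperpath (hk : 2 ≤ k) : (hyperpath k m).edgeSet.ncard = m := by
  have himage : (hyperpath k m).edgeSet =
      (fun i => Set.Icc (i * (k - 1)) ((i + 1) * (k - 1))) '' (Finset.range m : Set ℕ) := by
    ext e
    simp only [hyperpath, Set.mem_ofPred_eq, Finset.coe_range, Set.mem_image, Set.mem_Iio, eq_comm]
  rw [himage, Set.ncard_image_of_injective _ (injective_Icc_mul (by omega)),
    Set.ncard_coe_finset, Finset.card_range]

theorem isConnected_hyperpath (hk : 2 ≤ k) : (hyperpath k m).IsConnected := by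
  have hpos : 0 < k - 1 := by omega
  have hzero (x : ℕ) (hx : x ≤ m * (k - 1)) :
      Relation.ReflTransGen (hyperpath k m).Adj 0 x := by
    induction x with
    | zero => exact Relation.ReflTransGen.refl
    | succ x ih =>
      have hdiv := Nat.div_add_mod' x (k - 1)
      have hmod := Nat.mod_lt x hpos
      have hsucc : (x / (k - 1) + 1) * (k - 1) = x / (k - 1) * (k - 1) + (k - 1) :=
        Nat.succ_mul _ _
      have hblock : x / (k - 1) < m := (Nat.div_lt_iff_lt_mul hpos).2 hx
      exact (ih (by omega)).tail
        ⟨_, ⟨_, hblock, rfl⟩, ⟨by omega, by omega⟩, ⟨by omega, by omega⟩⟩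
  have hsymm : Std.Symm (hyperpath k m).Adj := ⟨fun _ _ h => h.symm⟩
  exact ⟨⟨0, Nat.zero_le _⟩,
    fun u hu v hv => (Std.Symm.symm _ _ (hzero u hu)).trans (hzero v hv)⟩

/- The last edge of a cycle would meet its two neighbours in the cycle in its first vertex. -/
theorem not_isCycle_hyperpath {l : ℕ} (v : Fin (l + 2) → ℕ) (e : Fin (l + 2) → Set ℕ) :
    ¬(hyperpath k m).IsCycle v e := by
  rintro ⟨hv, he, h⟩
  choose s _ hes using fun i => (h i).1
  obtain ⟨i, hi⟩ := Finite.exists_max s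
  have hlt {j : Fin (l + 2)} (hj : j ≠ i) : s j < s i :=
    lt_of_le_of_ne (hi j) fun hsij => hj (he (by rw [hes, hes, hsij]))
  have hsucc : i + 1 ≠ i := by simp
  have hpred : i - 1 ≠ i := by simp
  have hprev := (h (i - 1)).2.2
  have hnext := (h (i + 1)).2.1
  have hself := (h i).2
  rw [sub_add_cancel, hes] at hprev
  rw [hes] at hnext hself
  refine hsucc (hv ?_)
  rw [eq_mul_of_mem_Icc_of_mem_Icc (hlt hsucc) hnext hself.2,
    eq_mul_of_mem_Icc_of_mem_Icc (hlt hpred) hprev hself.1]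

theorem isHypertree_hyperpath (hk : 2 ≤ k) : (hyperpath k m).IsHypertree :=
  ⟨isConnected_hyperpath hk, fun _ => not_isCycle_hyperpath⟩

theorem degree_hyperpath_le_two (hk : 2 ≤ k) (v : ℕ) : (hyperpath k m).degree v ≤ 2 := by
  have hpos : 0 < k - 1 := by omega
  let block (i : ℕ) : Set ℕ := Set.Icc (i * (k - 1)) ((i + 1) * (k - 1))
  have hsub : {e ∈ (hyperpath k m).edgeSet | v ∈ e} ⊆
      {block (v / (k - 1)), block (v / (k - 1) - 1)} := by
    rintro e ⟨⟨i, -, rfl⟩, hv, hv'⟩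
    have hle : i ≤ v / (k - 1) := (Nat.le_div_iff_mul_le hpos).2 hv
    have hge : v / (k - 1) ≤ i + 1 := Nat.div_le_of_le_mul (by rwa [mul_comm])
    obtain rfl | rfl : i = v / (k - 1) ∨ i = v / (k - 1) - 1 := by omega
    · exact .inl rfl
    · exact .inr rfl
  exact (Set.ncard_le_ncard hsub (Set.toFinite _)).trans
    ((Set.ncard_insert_le _ _).trans_eq (by rw [Set.ncard_singleton]))

theorem degree_hyperpath_le_one {v i : ℕ} (hlt : i * (k - 1) < v) (hgt : v < (i + 1) * (k - 1)) :
    (hyperpath k m).degree v ≤ 1 := by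
  have hsub : {e ∈ (hyperpath k m).edgeSet | v ∈ e} ⊆
      {Set.Icc (i * (k - 1)) ((i + 1) * (k - 1))} := by
    rintro e ⟨⟨j, -, rfl⟩, hj⟩
    obtain hij | rfl | hij := lt_trichotomy i j
    · have := eq_mul_of_mem_Icc_of_mem_Icc hij ⟨hlt.le, hgt.le⟩ hj
      have := Nat.mul_le_mul_right (k - 1) (show i + 1 ≤ j from hij)
      omega
    · rfl
    · have := eq_mul_of_mem_Icc_of_mem_Icc hij hj ⟨hlt.le, hgt.le⟩
      omega
  exact (Set.ncard_le_ncard hsub (Set.finite_singleton _)).trans (Set.ncard_singleton _).le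

theorem sum_degree_hyperpath_le (hk : 2 ≤ k) (i : ℕ) :
    ∑ v ∈ Finset.Icc (i * (k - 1)) ((i + 1) * (k - 1)), (hyperpath k m).degree v ≤ k + 2 := by
  have hsucc : (i + 1) * (k - 1) = i * (k - 1) + (k - 1) := Nat.succ_mul _ _
  calc ∑ v ∈ Finset.Icc (i * (k - 1)) ((i + 1) * (k - 1)), (hyperpath k m).degree v
      ≤ ∑ v ∈ Finset.Icc (i * (k - 1)) ((i + 1) * (k - 1)),
          (1 + (if v = i * (k - 1) then 1 else 0) +
            if v = (i + 1) * (k - 1) then 1 else 0) := by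
        refine Finset.sum_le_sum fun v hv => ?_
        obtain ⟨hle, hge⟩ := Finset.mem_Icc.1 hv
        have htwo := degree_hyperpath_le_two (m := m) hk v
        have hone := degree_hyperpath_le_one (k := k) (m := m) (v := v) (i := i)
        split_ifs <;> omega
    _ = k + 2 := by
        rw [Finset.sum_add_distrib, Finset.sum_add_distrib, Finset.sum_ite_eq', Finset.sum_ite_eq',
          if_pos (Finset.left_mem_Icc.2 (by omega)), if_pos (Finset.right_mem_Icc.2 (by omega)),
          ← Finset.card_eq_sum_ones, Nat.card_Icc]
        omega

end Hyperpath

section Characterization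

open HTensor Hypergraph

section Families

variable {ι : Type*} [DecidableEq ι] {E F : Finset (Finset ι)} {k : ℕ}

/-- The local conditions that single out the hyperpath among the `k`-uniform hypertrees: no vertex
of degree three and no edge of degree sum exceeding `k + 2`. -/
structure HasPathDegrees (k : ℕ) (E : Finset (Finset ι)) : Prop where
  edgeDegree_le : ∀ v, edgeDegree E v ≤ 2
  edgeDegreeSum_le : ∀ e ∈ E, edgeDegreeSum E e ≤ k + 2

theorem hasPathDegrees_of_card_le_one (hE : ∀ e ∈ E, e.card = k) (hcard : E.card ≤ 1) :
    HasPathDegrees k E := by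
  have hdeg (v : ι) : edgeDegree E v ≤ 1 := (Finset.card_filter_le _ _).trans hcard
  refine ⟨fun v => (hdeg v).trans one_le_two, fun e he => ?_⟩
  have := Finset.sum_le_card_nsmul e _ 1 fun v _ => hdeg v
  rw [hE e he, smul_eq_mul, mul_one] at this
  exact this.trans (Nat.le_add_right k 2)

variable [Fintype ι] {R : Type*} [Field R] [LinearOrder R] [IsStrictOrderedRing R]

theorem exists_trace_edgeTensor_lt (hk : 3 ≤ k) (hEtree : IsEdgeTree E) (hFtree : IsEdgeTree F)
    (hE : ∀ e ∈ E, e.card = k) (hF : ∀ e ∈ F, e.card = k) (hcard : E.card = F.card)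
    (hEpath : HasPathDegrees k E) (hFpath : ¬HasPathDegrees k F) {α : R} (hα : α ≠ 0)
    (hα' : 0 < (1 - α) ^ k) :
    ∃ d, 1 ≤ d ∧ d ≤ k + 2 ∧
      (∀ t < d, trace t (edgeTensor k E α) = trace t (edgeTensor k F α)) ∧
      trace d (edgeTensor k E α) < trace d (edgeTensor k F α) := by
  have hFcard : 1 < F.card := not_le.1 fun h => hFpath (hasPathDegrees_of_card_le_one hF h)
  have hEne : ∀ e ∈ E, e.Nonempty := fun e he => Finset.card_pos.1 (by rw [hE e he]; omega)
  have hFne : ∀ e ∈ F, e.Nonempty := fun e he => Finset.card_pos.1 (by rw [hF e he]; omega)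
  have hEdeg (v : ι) : edgeDegree E v = 1 ∨ edgeDegree E v = 2 := by
    have hpos := hEtree.edgeDegree_pos (Finset.card_pos.1 (by omega)) hEne v
    have hle := hEpath.edgeDegree_le v
    omega
  by_cases hFle : ∀ v, edgeDegree F v ≤ 2
  · have hFdeg (v : ι) : edgeDegree F v = 1 ∨ edgeDegree F v = 2 := by
      have hpos := hFtree.edgeDegree_pos (Finset.card_pos.1 (by omega)) hFne v
      have hle := hFle v
      omega
    have hEsum (e) (he : e ∈ E) : edgeDegreeSum E e = k + 1 ∨ edgeDegreeSum E e = k + 2 := by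
      have hlt := hEtree.card_lt_edgeDegreeSum hEne (by omega) he
      have hle := hEpath.edgeDegreeSum_le e he
      rw [hE e he] at hlt
      omega
    obtain ⟨f, hf, hfsum⟩ : ∃ f ∈ F, k + 2 < edgeDegreeSum F f := by
      by_contra! hsum
      exact hFpath ⟨hFle, hsum⟩
    exact ⟨k + 2, by omega, le_rfl, fun t ht => trace_edgeTensor_eq_of_lt_add_two hk
      hEtree.hasCuts hFtree.hasCuts hE hF hcard hEdeg hFdeg α ht,
      trace_edgeTensor_add_two_lt hk hEtree.hasCuts hFtree.hasCuts hE hF hcard hEdeg hFdeg hEsum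
        hf hfsum hα hα'⟩
  · push Not at hFle
    obtain ⟨v, hv⟩ := hFle
    exact ⟨2, one_le_two, by omega, fun t ht => trace_edgeTensor_eq_of_lt_two (by omega)
      hEtree.hasCuts hFtree.hasCuts hE hF hcard α ht,
      trace_edgeTensor_two_lt hk hEtree.hasCuts hFtree.hasCuts hE hF hcard hEdeg hv hα⟩

end Families

variable {ι V : Type*} [Fintype ι] {T : Hypergraph V} {k m : ℕ}

theorem hasPathDegrees_hyperpath [DecidableEq ι] (hk : 2 ≤ k)
    (σ : ι ≃ (hyperpath k m).vertexSet) : HasPathDegrees k (labeledEdges σ) := by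
  refine ⟨fun v => (edgeDegree_labeledEdges σ v).trans_le (degree_hyperpath_le_two hk _),
    fun e he => ?_⟩
  obtain ⟨i, -, hi⟩ := mem_labeledEdges.1 he
  have hmap : e.map ⟨fun i => (σ i : ℕ), injective_labeling σ⟩ =
      Finset.Icc (i * (k - 1)) ((i + 1) * (k - 1)) :=
    Finset.coe_injective <| by rw [Finset.coe_map, Finset.coe_Icc]; exact hi
  rw [edgeDegreeSum_labeledEdges, hmap]
  exact sum_degree_hyperpath_le hk i

theorem isIsomorphic_hyperpath_of_bijOn {τ : ι ≃ T.vertexSet} {σ : ℕ → ι}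
    (hσ : Set.BijOn σ (Set.Iic (m * (k - 1))) Set.univ)
    (hE : ∀ e : Finset ι, e ∈ labeledEdges τ ↔
      ∃ i < m, σ '' Set.Icc (i * (k - 1)) ((i + 1) * (k - 1)) = e) :
    (hyperpath k m).IsIsomorphic T := by
  classical
  let ρ : (hyperpath k m).vertexSet ≃ T.vertexSet :=
    (hσ.equiv σ).trans ((Equiv.Set.univ ι).trans τ)
  refine ⟨ρ, fun s => ?_⟩
  have hs : Subtype.val '' s ⊆ Set.Iic (m * (k - 1)) := by
    rintro _ ⟨x, -, rfl⟩
    exact x.2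
  have himage : Subtype.val '' (ρ '' s) =
      (fun i => (τ i : V)) '' ((σ '' (Subtype.val '' s)).toFinset : Finset ι) := by
    rw [Set.coe_toFinset, Set.image_image, Set.image_image, Set.image_image]
    rfl
  rw [himage, ← mem_labeledEdges, hE, Set.coe_toFinset]
  refine exists_congr fun i => and_congr_right fun hi => ?_
  rw [hσ.injOn.image_eq_image_iff (fun x hx => hx.2.trans (Nat.mul_le_mul_right _ hi)) hs, eq_comm]

theorem isIsomorphic_hyperpath_of_hasPathDegrees [DecidableEq ι] (hk : 2 ≤ k)
    (hT : T.IsUniform k) (htree : T.IsHypertree) (τ : ι ≃ T.vertexSet)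
    (hpath : HasPathDegrees k (labeledEdges τ)) :
    (hyperpath k T.edgeSet.ncard).IsIsomorphic T := by
  obtain ⟨σ, hσ, hE⟩ := (isEdgeTree_labeledEdges htree τ).exists_bijOn_Iic hk
    (fun e he => card_eq_of_mem_labeledEdges hT he) hpath.edgeDegree_le hpath.edgeDegreeSum_le
  rw [card_labeledEdges] at hσ hE
  exact isIsomorphic_hyperpath_of_bijOn hσ hE

end Characterization

section Order

open HTensor Hypergraph

variable {V : Type*} {T : Hypergraph V} [Fintype T.vertexSet] {k : ℕ}

theorem card_vertexSet_eq (hk : 1 ≤ k) (hT : T.IsUniform k) (htree : T.IsHypertree) :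
    Fintype.card T.vertexSet = T.edgeSet.ncard * (k - 1) + 1 := by
  classical
  rw [(isEdgeTree_labeledEdges htree (Equiv.refl _)).card_eq hk
    fun e he => card_eq_of_mem_labeledEdges hT he, card_labeledEdges]

theorem add_two_le_mul_pow_sub_one {n : ℕ} (hk : 3 ≤ k) (hn : 2 * (k - 1) + 1 ≤ n) :
    k + 2 ≤ n * (k - 1) ^ (n - 1) - 1 := by
  have hpow : 2 ≤ (k - 1) ^ (n - 1) :=
    (by omega : 2 ≤ k - 1).trans (Nat.le_self_pow (by omega) _)
  have := Nat.mul_le_mul_left n hpow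
  omega

theorem alphaLT_hyperpath {α : ℝ} (hk : 3 ≤ k) (hα : α ≠ 0) (hα' : 0 < (1 - α) ^ k)
    (hT : T.IsUniform k) (htree : T.IsHypertree)
    (hiso : ¬(hyperpath k T.edgeSet.ncard).IsIsomorphic T) :
    AlphaLT k α (hyperpath k T.edgeSet.ncard) T := by
  classical
  set P := hyperpath k T.edgeSet.ncard
  have hP : P.IsUniform k := isUniform_hyperpath (by omega)
  have hPtree : P.IsHypertree := isHypertree_hyperpath (by omega)
  have hncard : P.edgeSet.ncard = T.edgeSet.ncard := ncard_edgeSet_hyperpath (by omega)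
  have hPcard := card_vertexSet_eq (by omega) hP hPtree
  have hcard : Fintype.card P.vertexSet = Fintype.card T.vertexSet := by
    rw [hPcard, card_vertexSet_eq (by omega) hT htree, hncard]
  let σ : P.vertexSet ≃ T.vertexSet := Fintype.equivOfCardEq hcard
  have hTpath : ¬HasPathDegrees k (labeledEdges σ) := fun hpath =>
    hiso (isIsomorphic_hyperpath_of_hasPathDegrees (by omega) hT htree σ hpath)
  have htwo : 2 ≤ P.edgeSet.ncard := by
    by_contra! hlt
    refine hTpath (hasPathDegrees_of_card_le_one (fun e => card_eq_of_mem_labeledEdges hT) ?_)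
    rw [card_labeledEdges]
    omega
  obtain ⟨d, hd0, hd, heq, hlt⟩ := exists_trace_edgeTensor_lt hk
    (isEdgeTree_labeledEdges hPtree (Equiv.refl _)) (isEdgeTree_labeledEdges htree σ)
    (fun e => card_eq_of_mem_labeledEdges hP) (fun e => card_eq_of_mem_labeledEdges hT)
    (by rw [card_labeledEdges, card_labeledEdges, hncard])
    (hasPathDegrees_hyperpath (by omega) _) hTpath hα hα'
  have hbound := add_two_le_mul_pow_sub_one (n := Fintype.card P.vertexSet) hk
    (hPcard.symm ▸ Nat.succ_le_succ (Nat.mul_le_mul_right _ htwo))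
  simp only [← alphaTrace_eq_trace_labeledEdges] at heq hlt
  exact ⟨hcard, d, hd0, hd.trans hbound, heq, hlt⟩

end Order

theorem mainTheorem4_general (k m : ℕ) (hk : 3 ≤ k) (α : ℝ) (hα : α ≠ 0) (hα' : 0 < (1 - α) ^ k) :
    ((Hypergraph.hyperpath k m).IsUniform k ∧
      (Hypergraph.hyperpath k m).IsHypertree ∧
      (Hypergraph.hyperpath k m).edgeSet.ncard = m) ∧
    ∀ (V : Type*) (T : Hypergraph V) [Fintype T.vertexSet],
      T.IsUniform k → T.IsHypertree → T.edgeSet.ncard = m →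
        Hypergraph.AlphaLE k α (Hypergraph.hyperpath k m) T ∧
        (¬ (Hypergraph.hyperpath k m).IsIsomorphic T →
          Hypergraph.AlphaLT k α (Hypergraph.hyperpath k m) T) := by
  refine ⟨⟨isUniform_hyperpath (by omega), isHypertree_hyperpath (by omega),
    ncard_edgeSet_hyperpath (by omega)⟩, ?_⟩
  rintro V T _ hT htree rfl
  have hlt := alphaLT_hyperpath hk hα hα' hT htree
  refine ⟨?_, hlt⟩
  by_cases hiso : (Hypergraph.hyperpath k T.edgeSet.ncard).IsIsomorphic T
  · exact .inr (alphaEq_of_isIsomorphic hiso k α)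
  · exact .inl (hlt hiso)

theorem mainTheorem4 (k m : ℕ) (hk : 3 ≤ k) (α : ℝ) (hα0 : 0 < α) (hα1 : α < 1) :
    ((Hypergraph.hyperpath k m).IsUniform k ∧
      (Hypergraph.hyperpath k m).IsHypertree ∧
      (Hypergraph.hyperpath k m).edgeSet.ncard = m) ∧
    ∀ (V : Type*) (T : Hypergraph V) [Fintype T.vertexSet],
      T.IsUniform k → T.IsHypertree → T.edgeSet.ncard = m →
        Hypergraph.AlphaLE k α (Hypergraph.hyperpath k m) T ∧
        (¬ (Hypergraph.hyperpath k m).IsIsomorphic T →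
          Hypergraph.AlphaLT k α (Hypergraph.hyperpath k m) T) :=
  mainTheorem4_general k m hk α hα0.ne' (pow_pos (sub_pos.2 hα1) k)
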